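/- Let $G$ be a compact connected (finite-dimensional, real, smooth) Lie group with identity $e$ and Lie algebra $\mathfrak g=T_eG$, and let $\langle\cdot,\cdot\rangle$ be a bi-invariant Riemannian metric on $G$. For $\xi\in\mathfrak g^*$ let $X_\xi\in\mathfrak g$ be the vector with $\xi(Y)=\langle X_\xi,Y\rangle$ for all $Y\in\mathfrak g$, and put $\mathrm{ad}^*_Y\xi=\xi\circ\mathrm{ad}_Y$. Regard $G\times\mathfrak g$ as the semidirect product Lie group with multiplication $(x,Y)(g,Z)=(xg,\mathrm{Ad}_{g^{-1}}Y+Z)$, with left translations $L_{(x,Y)}$. Let $\Omega_1=-d\theta$ be the canonical symplectic form on $T^*(G\times\mathfrak g)$, where $\theta$ is the tautological one-form, and let $$\rho:T^*(G\times\mathfrak g)\to G\times\mathfrak g\times\mathfrak g^*\times\mathfrak g^*,\qquad \rho(\alpha)=\bigl(x,Y,\ \alpha\circ T_{(e,0)}L_{(x,Y)}\bigr)\quad\text{for }\alpha\in T^*_{(x,Y)}(G\times\mathfrak g),$$ be the left trivialization, where the dual of $T_{(e,0)}(G\times\mathfrak g)=\mathfrak g\times\mathfrak g$ is identified with $\mathfrak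 g^*\times\mathfrak g^*$. Let $H_1(\alpha_x,Y,\xi)=\alpha_x(T_eL_xY)+\frac12\xi(X_\xi)$ on $T^*(G\times\mathfrak g)$. Then $\rho$ is a diffeomorphism, and the left trivialization $H=H_1\circ\rho^{-1}$ of $H_1$ is $$H(x,Y,\mu,\xi)=\mu(Y)+\tfrac12\,\xi(X_\xi).$$ Moreover, with respect to the two-form $\Omega=(\rho^{-1})^*\Omega_1$ on $G\times\mathfrak g\times\mathfrak g^*\times\mathfrak g^*$, there is exactly one vector field $X_H$ with $i_{X_H}\Omega=dH$, it is given by $$X_H(x,Y,\mu,\xi)=\bigl(T_eL_xY,\ X_\xi,\ 0,\ -\mu+\mathrm{ad}^*_Y\xi\bigr),$$ and a curve $(x(t),Y(t),\mu(t),\xi(t))$ is an integral curve of $X_H$ (a motion of the Hamiltonian system $(G\times\mathfrak g\times\mathfrak g^*\times\mathfrak g^*,\Omega,H)$) on a set $s\subseteq\mathbb R$ of times (for instance an interval) if and only if, for all $t\in s$, $$\dot x=T_eL_xY,\qquad \dot Y=X_\xi,\qquad \dot\mu=0,\qquad \dot\xi=-\mu+\mathrm{ad}^*_Y\xi .$$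 -/

import Mathlib

open Set Bundle
open scoped Manifold ContDiff

noncomputable section

namespace CubicHam

/-! ### Differential forms on manifolds -/

section Forms

variable {E : Type*} [NormedAddCommGroup E] [NormedSpace ℝ E]
  {H : Type*} [TopologicalSpace H]
  {M : Type*} [TopologicalSpace M] [ChartedSpace H M]
  {E' : Type*} [NormedAddCommGroup E'] [NormedSpace ℝ E']
  {H' : Type*} [TopologicalSpace H']
  {M' : Type*} [TopologicalSpace M'] [ChartedSpace H' M']

/-- A (not necessarily smooth) differential `n`-form on the manifold `M`. -/
abbrev DiffForm (I : ModelWithCorners ℝ E H) (M : Type*) [TopologicalSpace M] [ChartedSpace H M]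
    (n : ℕ) : Type _ :=
  (p : M) → TangentSpace I p [⋀^Fin n]→L[ℝ] ℝ

/-- The pullback `f^* η` of a differential form under a map `f`. -/
def DiffForm.pullback (I : ModelWithCorners ℝ E H) (I' : ModelWithCorners ℝ E' H') {n : ℕ}
    (f : M → M') (η : DiffForm I' M' n) : DiffForm I M n :=
  fun p => (η (f p)).compContinuousLinearMap (mfderiv I I' f p)

/-- The expression of the differential form `η` in the preferred chart `φ` at `p`, that is,
the pullback of `ω` under `φ⁻¹`. -/
def DiffForm.inChart (I : ModelWithCorners ℝ E H) {n : ℕ} (η : DiffForm I M n) (p : M) :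
    E → E [⋀^Fin n]→L[ℝ] ℝ :=
  fun y => (η ((extChartAt I p).symm y)).compContinuousLinearMap
    (mfderivWithin 𝓘(ℝ, E) I (extChartAt I p).symm (range I) y)

/-- The exterior derivative of a differential form on a manifold: its value at `p` is computed in
the preferred chart at `p`, and pulled back to the manifold. -/
def DiffForm.d (I : ModelWithCorners ℝ E H) {n : ℕ} (η : DiffForm I M n) : DiffForm I M (n + 1) :=
  fun p => (extDerivWithin (DiffForm.inChart I η p) (range I) (extChartAt I p p)).compContinuousLinearMap
    (mfderiv I 𝓘(ℝ, E) (extChartAt I p) p)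

/-- `X` is the Hamiltonian vector field of the function `h` for the two-form `Ω`, i.e.
`i_X Ω = dh`. -/
def IsHamiltonianVectorField (I : ModelWithCorners ℝ E H) (Ω : DiffForm I M 2) (h : M → ℝ)
    (X : (p : M) → TangentSpace I p) : Prop :=
  ∀ (p : M) (w : TangentSpace I p), Ω p ![X p, w] = mfderiv I 𝓘(ℝ, ℝ) h p w

/-- The cotangent bundle `T^*M`, as a manifold. -/
abbrev Cotangent (I : ModelWithCorners ℝ E H) (M : Type*) [TopologicalSpace M]
    [ChartedSpace H M] : Type _ :=
  TotalSpace (E →L[ℝ] ℝ) (fun p : M => TangentSpace I p →L[ℝ] ℝ)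

/-- The model with corners of the cotangent bundle. -/
abbrev cotangentModel (I : ModelWithCorners ℝ E H) :
    ModelWithCorners ℝ (E × (E →L[ℝ] ℝ)) (ModelProd H (E →L[ℝ] ℝ)) :=
  I.prod 𝓘(ℝ, E →L[ℝ] ℝ)

/-- The tautological (Liouville) one-form `θ` on `T^*M`: `θ_α(v) = α(T π v)`, where
`π : T^*M → M` is the projection. -/
def liouvilleForm (I : ModelWithCorners ℝ E H) (M : Type*) [TopologicalSpace M]
    [ChartedSpace H M] [IsManifold I 1 M] : DiffForm (cotangentModel I) (Cotangent I M) 1 :=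
  fun α => ContinuousAlternatingMap.ofSubsingleton ℝ (TangentSpace (cotangentModel I) α) ℝ
    (0 : Fin 1) (α.2.comp (mfderiv (cotangentModel I) I (fun β : Cotangent I M => β.1) α))

/-- The canonical symplectic two-form `-dθ` on `T^*M` (locally `∑ dqⁱ ∧ dpᵢ`). -/
def canonicalForm (I : ModelWithCorners ℝ E H) (M : Type*) [TopologicalSpace M]
    [ChartedSpace H M] [IsManifold I 1 M] : DiffForm (cotangentModel I) (Cotangent I M) 2 :=
  fun α => -DiffForm.d (cotangentModel I) (liouvilleForm I M) α

end Forms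

section LieGroup

variable {E : Type*} [NormedAddCommGroup E] [NormedSpace ℝ E]
  {H : Type*} [TopologicalSpace H] (I : ModelWithCorners ℝ E H)
  (G : Type*) [TopologicalSpace G] [ChartedSpace H G] [Group G]

/-! ### The Lie algebra, as a finite-dimensional vector space and a manifold -/

/-- The norm of the model space `E`, on the Lie algebra. Auxiliary to `instNormedLie`. -/
abbrev normedLieAux : NormedAddCommGroup (GroupLieAlgebra I G) :=
  inferInstanceAs (NormedAddCommGroup E)

/-- The Lie algebra `𝔤 = T_e G` with the norm of the model space `E`. The norm only serves to regard
the finite-dimensional vector space `𝔤` as a manifold; the topology and the vector space structure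
are the existing ones of the tangent space. -/
instance instNormedLie : NormedAddCommGroup (GroupLieAlgebra I G) :=
  { toNorm := (normedLieAux I G).toNorm
    toAddCommGroup := instAddCommGroupTangentSpace I (1 : G)
    toPseudoMetricSpace := (normedLieAux I G).toPseudoMetricSpace.replaceTopology
      (U := instTopologicalSpaceTangentSpace I (1 : G)) rfl
    eq_of_dist_eq_zero := (normedLieAux I G).eq_of_dist_eq_zero
    dist_eq := (normedLieAux I G).dist_eq }

instance instNormedSpaceLie : NormedSpace ℝ (GroupLieAlgebra I G) :=
  { toModule := instModuleTangentSpace I (1 : G)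
    norm_smul_le := fun (a : ℝ) (b : E) => norm_smul_le a b }

instance instFiniteDimensionalLie [h : FiniteDimensional ℝ E] :
    FiniteDimensional ℝ (GroupLieAlgebra I G) := h

instance instLieGroupMinSmoothness [LieGroup I ∞ G] : LieGroup I (minSmoothness ℝ 3) G := by
  rw [minSmoothness_of_isRCLikeNormedField]; infer_instance

/-- The dual space `𝔤^*` of the Lie algebra. -/
abbrev LieDual : Type _ := GroupLieAlgebra I G →L[ℝ] ℝ

variable {G}

/-- The adjoint representation of the group: `Ad_x` is the derivative at `e` of
`y ↦ x y x⁻¹`. -/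
def Ad (x : G) : GroupLieAlgebra I G →L[ℝ] GroupLieAlgebra I G :=
  mfderiv I I (fun y : G => x * y * x⁻¹) 1

/-- `ad^*_Y ξ = ξ ∘ ad_Y`. -/
def coad [LieGroup I ∞ G] [FiniteDimensional ℝ E] (Y : GroupLieAlgebra I G) (ξ : LieDual I G) :
    LieDual I G :=
  ξ.comp (LinearMap.toContinuousLinearMap (LieAlgebra.ad ℝ (GroupLieAlgebra I G) Y))

theorem coad_apply [LieGroup I ∞ G] [FiniteDimensional ℝ E] (Y Z : GroupLieAlgebra I G)
    (ξ : LieDual I G) : coad I Y ξ Z = ξ ⁅Y, Z⁆ := rfl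

theorem Ad_one [LieGroup I ∞ G] : Ad I (1 : G) = ContinuousLinearMap.id ℝ _ := by
  have h : (fun y : G => 1 * y * (1 : G)⁻¹) = id := by ext y; simp
  unfold Ad
  rw [h]
  exact mfderiv_id

theorem mdifferentiable_conj [LieGroup I ∞ G] (x : G) :
    MDifferentiable I I (fun y : G => x * y * x⁻¹) := by
  have h : ContMDiff I I ∞ (fun y : G => x * y * x⁻¹) :=
    (contMDiff_mul_right (a := x⁻¹)).comp (contMDiff_mul_left (a := x))
  exact h.mdifferentiable (by simp)

theorem Ad_mul [LieGroup I ∞ G] (x y : G) : Ad I (x * y) = (Ad I x).comp (Ad I y) := by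
  have h1 : (fun z : G => y * z * y⁻¹) 1 = 1 := by simp
  have hx : HasMFDerivAt I I (fun z : G => x * z * x⁻¹) ((fun z : G => y * z * y⁻¹) 1)
      (Ad I x) := by
    rw [h1]; exact (mdifferentiable_conj I x 1).hasMFDerivAt
  have hy : HasMFDerivAt I I (fun z : G => y * z * y⁻¹) 1 (Ad I y) :=
    (mdifferentiable_conj I y 1).hasMFDerivAt
  have h : (fun z : G => x * y * z * (x * y)⁻¹) =
      (fun z : G => x * z * x⁻¹) ∘ (fun z : G => y * z * y⁻¹) := by
    ext z; simp [mul_assoc]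
  unfold Ad
  rw [h]
  exact (hx.comp 1 hy).mfderiv

/-! ### The semidirect product -/

/-- The semidirect product of `G` and the abelian group `𝔤` under the right action
`(x, Y) ↦ Ad_{x⁻¹} Y`: the underlying manifold is `G × 𝔤`, and
`(x, Y) (g, Z) = (x g, Ad_{g⁻¹} Y + Z)`. -/
instance instGroupSemidirect [LieGroup I ∞ G] : Group (G × GroupLieAlgebra I G) where
  mul p q := (p.1 * q.1, Ad I q.1⁻¹ p.2 + q.2)
  one := (1, 0)
  inv p := (p.1⁻¹, -Ad I p.1 p.2)
  mul_assoc p q r := by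
    refine Prod.ext (mul_assoc _ _ _) ?_
    change Ad I r.1⁻¹ (Ad I q.1⁻¹ p.2 + q.2) + r.2 =
      Ad I (q.1 * r.1)⁻¹ p.2 + (Ad I r.1⁻¹ q.2 + r.2)
    rw [mul_inv_rev, Ad_mul, map_add, add_assoc]
    rfl
  one_mul p := by
    refine Prod.ext (one_mul _) ?_
    change Ad I p.1⁻¹ 0 + p.2 = p.2
    rw [map_zero, zero_add]
  mul_one p := by
    refine Prod.ext (mul_one _) ?_
    change Ad I (1 : G)⁻¹ p.2 + 0 = p.2
    rw [inv_one, Ad_one, add_zero]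
    rfl
  inv_mul_cancel p := by
    refine Prod.ext (inv_mul_cancel _) ?_
    change Ad I p.1⁻¹ (-Ad I p.1 p.2) + p.2 = 0
    have h : Ad I p.1⁻¹ (Ad I p.1 p.2) = p.2 := by
      rw [← ContinuousLinearMap.comp_apply, ← Ad_mul, inv_mul_cancel, Ad_one]
      rfl
    rw [map_neg, h, neg_add_cancel]

theorem semidirect_mul_def [LieGroup I ∞ G] (x g : G) (Y Z : GroupLieAlgebra I G) :
    ((x, Y) * (g, Z) : G × GroupLieAlgebra I G) = (x * g, Ad I g⁻¹ Y + Z) := rfl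

/-- The model with corners of the manifold `G × 𝔤`. -/
abbrev semiModel (G : Type*) [TopologicalSpace G] [ChartedSpace H G] [Group G] :
    ModelWithCorners ℝ (E × GroupLieAlgebra I G) (ModelProd H (GroupLieAlgebra I G)) :=
  I.prod 𝓘(ℝ, GroupLieAlgebra I G)

/-- The canonical identification of `T_x G × 𝔤` with `T_{(x, Y)} (G × 𝔤)`. -/
def semiTangent (p : G × GroupLieAlgebra I G) :
    (TangentSpace I p.1 × GroupLieAlgebra I G) ≃L[ℝ] TangentSpace (semiModel I G) p :=
  ContinuousLinearEquiv.refl ℝ (E × GroupLieAlgebra I G)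

/-- The derivative `T_{(e, 0)} L_p` of the left translation `L_p` of the semidirect product. -/
def semiLeft [LieGroup I ∞ G] (p : G × GroupLieAlgebra I G) :
    TangentSpace (semiModel I G) (1 : G × GroupLieAlgebra I G) →L[ℝ]
      TangentSpace (semiModel I G) p :=
  mfderiv (semiModel I G) (semiModel I G) (fun q : G × GroupLieAlgebra I G => p * q) 1

/-- The derivative `T_p L_{p⁻¹}`, inverse to `T_{(e, 0)} L_p`. -/
def semiLeftInv [LieGroup I ∞ G] (p : G × GroupLieAlgebra I G) :
    TangentSpace (semiModel I G) p →L[ℝ]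
      TangentSpace (semiModel I G) (1 : G × GroupLieAlgebra I G) :=
  mfderiv (semiModel I G) (semiModel I G) (fun q : G × GroupLieAlgebra I G => p⁻¹ * q) p

/-! ### The left trivialization of the cotangent bundle of the semidirect product -/

/-- The cotangent bundle `T^*(G × 𝔤)`. -/
abbrev CotSemi (G : Type*) [TopologicalSpace G] [ChartedSpace H G] [Group G]
    [LieGroup I ∞ G] : Type _ :=
  Cotangent (semiModel I G) (G × GroupLieAlgebra I G)

/-- The phase space `G × 𝔤 × 𝔤^* × 𝔤^*`. -/
abbrev Phase (G : Type*) [TopologicalSpace G] [ChartedSpace H G] [Group G] : Type _ :=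
  G × GroupLieAlgebra I G × LieDual I G × LieDual I G

/-- The model with corners of the phase space. -/
abbrev phaseModel (G : Type*) [TopologicalSpace G] [ChartedSpace H G] [Group G] :
    ModelWithCorners ℝ (E × GroupLieAlgebra I G × LieDual I G × LieDual I G)
      (ModelProd H (ModelProd (GroupLieAlgebra I G) (ModelProd (LieDual I G) (LieDual I G)))) :=
  I.prod (𝓘(ℝ, GroupLieAlgebra I G).prod (𝓘(ℝ, LieDual I G).prod 𝓘(ℝ, LieDual I G)))

/-- The canonical identification of `T_x G × 𝔤 × 𝔤^* × 𝔤^*` with the tangent space of the phase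
space at `(x, Y, μ, ξ)`. -/
def phaseTangent (z : Phase I G) :
    (TangentSpace I z.1 × GroupLieAlgebra I G × LieDual I G × LieDual I G) ≃L[ℝ]
      TangentSpace (phaseModel I G) z :=
  ContinuousLinearEquiv.refl ℝ (E × GroupLieAlgebra I G × LieDual I G × LieDual I G)

variable [LieGroup I ∞ G]

/-- The left trivialization `ρ : T^*(G × 𝔤) → G × 𝔤 × 𝔤^* × 𝔤^*`,
`ρ(α) = (p, α ∘ T_{(e, 0)} L_p)` for `α ∈ T^*_p (G × 𝔤)`, where the dual of
`T_{(e, 0)} (G × 𝔤) = 𝔤 × 𝔤` is identified with `𝔤^* × 𝔤^*`. -/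
def leftTriv (α : CotSemi I G) : Phase I G :=
  let m : GroupLieAlgebra I G × GroupLieAlgebra I G →L[ℝ] ℝ :=
    (α.2.comp (semiLeft I α.1)).comp (semiTangent I (1 : G × GroupLieAlgebra I G) :
      (GroupLieAlgebra I G × GroupLieAlgebra I G) →L[ℝ] _)
  (α.1.1, α.1.2, m.comp (ContinuousLinearMap.inl ℝ _ _), m.comp (ContinuousLinearMap.inr ℝ _ _))

/-- The inverse `ρ⁻¹` of the left trivialization:
`ρ⁻¹(x, Y, μ, ξ) = (μ, ξ) ∘ T_p L_{p⁻¹} ∈ T^*_p (G × 𝔤)` with `p = (x, Y)`. -/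
def leftTrivInv (z : Phase I G) : CotSemi I G :=
  let p : G × GroupLieAlgebra I G := (z.1, z.2.1)
  let m : GroupLieAlgebra I G × GroupLieAlgebra I G →L[ℝ] ℝ := z.2.2.1.coprod z.2.2.2
  ⟨p, (m.comp ((semiTangent I (1 : G × GroupLieAlgebra I G)).symm :
    _ →L[ℝ] (GroupLieAlgebra I G × GroupLieAlgebra I G))).comp (semiLeftInv I p)⟩

/-- The symplectic form `Ω = (ρ⁻¹)^* Ω₁` on the phase space, where `Ω₁` is the canonical symplectic
form of `T^*(G × 𝔤)`. -/
def phaseForm : DiffForm (phaseModel I G) (Phase I G) 2 :=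
  DiffForm.pullback (phaseModel I G) (cotangentModel (semiModel I G)) (leftTrivInv I)
    (canonicalForm (semiModel I G) (G × GroupLieAlgebra I G))

/-! ### The metric and the Hamiltonian -/

/-- A smooth Riemannian metric on `G`. -/
abbrev Metric (G : Type*) [TopologicalSpace G] [ChartedSpace H G] [Group G]
    [LieGroup I ∞ G] : Type _ :=
  ContMDiffRiemannianMetric I ∞ E (fun x : G => TangentSpace I x)

/-- The metric is bi-invariant: left and right translations are isometries. -/
def IsBiInvariant (m : Metric I G) : Prop :=
  ∀ (a x : G) (v w : TangentSpace I x),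
    m.inner (a * x) (mfderiv I I (fun y : G => a * y) x v) (mfderiv I I (fun y : G => a * y) x w)
      = m.inner x v w ∧
    m.inner (x * a) (mfderiv I I (fun y : G => y * a) x v) (mfderiv I I (fun y : G => y * a) x w)
      = m.inner x v w

/-- The vector `X_ξ ∈ 𝔤` identified with `ξ ∈ 𝔤^*` by the metric, see `inner_sharp`. -/
def sharp (m : Metric I G) (ξ : LieDual I G) : GroupLieAlgebra I G :=
  (m.inner (1 : G)).inverse ξ

theorem inner_sharp [FiniteDimensional ℝ E] (m : Metric I G) (ξ : LieDual I G)
    (Y : GroupLieAlgebra I G) : m.inner (1 : G) (sharp I m ξ) Y = ξ Y := by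
  let f : GroupLieAlgebra I G →L[ℝ] LieDual I G := m.inner (1 : G)
  have hinj : Function.Injective f := by
    rw [injective_iff_map_eq_zero]
    intro v hv
    by_contra hne
    have h1 := m.pos (1 : G) v hne
    have h2 : m.inner (1 : G) v v = 0 := by
      change f v v = 0
      rw [hv]; rfl
    exact absurd h2 h1.ne'
  have hdim : Module.finrank ℝ (GroupLieAlgebra I G) = Module.finrank ℝ (LieDual I G) := by
    rw [← (LinearMap.toContinuousLinearMap (𝕜 := ℝ) (E := GroupLieAlgebra I G)
      (F' := ℝ)).finrank_eq]
    exact (Subspace.dual_finrank_eq (K := ℝ) (V := GroupLieAlgebra I G)).symm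
  let e : GroupLieAlgebra I G ≃L[ℝ] LieDual I G :=
    (LinearEquiv.ofInjectiveOfFinrankEq (f : GroupLieAlgebra I G →ₗ[ℝ] LieDual I G) hinj
      hdim).toContinuousLinearEquiv
  have he : (e : GroupLieAlgebra I G →L[ℝ] LieDual I G) = f := by ext v w; rfl
  have hs : sharp I m ξ = e.symm ξ := by
    change f.inverse ξ = _
    rw [← he, ContinuousLinearMap.inverse_equiv]; rfl
  rw [hs]
  change f (e.symm ξ) Y = ξ Y
  rw [← he]
  change e (e.symm ξ) Y = ξ Y
  rw [e.apply_symm_apply]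

/-- The Hamiltonian on `T^*(G × 𝔤)`: `H₁(α_x, Y, ξ) = α_x(T_e L_x Y) + ½ ξ(X_ξ)`, where an element
of `T^*_{(x, Y)} (G × 𝔤)` is identified with a pair `(α_x, ξ) ∈ T^*_x G × 𝔤^*`. -/
def hamCot (m : Metric I G) (β : CotSemi I G) : ℝ :=
  let b : TangentSpace I β.1.1 × GroupLieAlgebra I G →L[ℝ] ℝ :=
    β.2.comp (semiTangent I β.1 : _ →L[ℝ] TangentSpace (semiModel I G) β.1)
  let ξ : LieDual I G := b.comp (ContinuousLinearMap.inr ℝ _ _)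
  b (mulInvariantVectorField β.1.2 β.1.1, 0) + 1 / 2 * ξ (sharp I m ξ)

/-- The left-trivialized Hamiltonian `H(x, Y, μ, ξ) = μ(Y) + ½ ξ(X_ξ)`. -/
def ham (m : Metric I G) (z : Phase I G) : ℝ :=
  z.2.2.1 z.2.1 + 1 / 2 * z.2.2.2 (sharp I m z.2.2.2)

end LieGroup

end CubicHam

end

open Filter VectorField Topology

noncomputable section

namespace CubicHam

section Calculus

variable {E : Type*} [NormedAddCommGroup E] [NormedSpace ℝ E]

/-- If `(0, f a)` and `(Y, 0)` have the same image under the derivative of a "multiplication" `m` at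
`(a, e)` and `(e, a)`, then the derivative of `f` is a Lie bracket of "left invariant" fields. -/
theorem fderiv_eq_lieBracket_of_partial_eq {m : E × E → E} {f : E → E} {e X Y : E}
    (hm : ContDiffAt ℝ 2 m (e, e)) (hf : DifferentiableAt ℝ f e) (hfe : f e = Y)
    (hid : ∀ v, fderiv ℝ m (e, e) (0, v) = v)
    (h : ∀ᶠ a in 𝓝 e, fderiv ℝ m (e, a) (Y, 0) = fderiv ℝ m (a, e) (0, f a)) :
    fderiv ℝ f e X = lieBracket ℝ (fun a => fderiv ℝ m (a, e) (0, Y))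
      (fun a => fderiv ℝ m (a, e) (0, X)) e := by
  have hd : DifferentiableAt ℝ (fderiv ℝ m) (e, e) :=
    (hm.fderiv_right (m := 1) (by norm_num)).differentiableAt (by norm_num)
  have hsymm : IsSymmSndFDerivAt ℝ m (e, e) := hm.isSymmSndFDerivAt (by simp)
  set D := fderiv ℝ (fderiv ℝ m) (e, e) with hD
  have hl : HasFDerivAt (fun a : E => (a, e)) (ContinuousLinearMap.inl ℝ E E) e :=
    hasFDerivAt_prodMk_left e e
  have hr : HasFDerivAt (fun a : E => (e, a)) (ContinuousLinearMap.inr ℝ E E) e :=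
    hasFDerivAt_prodMk_right e e
  have hL : HasFDerivAt (fun a => fderiv ℝ m (a, e)) (D.comp (ContinuousLinearMap.inl ℝ E E)) e :=
    HasFDerivAt.comp (g := fderiv ℝ m) e hd.hasFDerivAt hl
  have hR : HasFDerivAt (fun a => fderiv ℝ m (e, a)) (D.comp (ContinuousLinearMap.inr ℝ E E)) e :=
    HasFDerivAt.comp (g := fderiv ℝ m) e hd.hasFDerivAt hr
  have hLv : ∀ v w, fderiv ℝ (fun a => fderiv ℝ m (a, e) (0, v)) e w = D (w, 0) (0, v) := by
    intro v w
    rw [(hL.clm_apply (hasFDerivAt_const ((0 : E), v) e)).fderiv]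
    simp
  have h1 : HasFDerivAt (fun a => fderiv ℝ m (e, a) (Y, 0)) _ e :=
    hR.clm_apply (hasFDerivAt_const (Y, (0 : E)) e)
  have h2 : HasFDerivAt (fun a => fderiv ℝ m (a, e) (0, f a)) _ e :=
    hL.clm_apply ((hasFDerivAt_const (0 : E) e).prodMk hf.hasFDerivAt)
  have h3 := congrArg (fun A => A X) (h1.unique (h2.congr_of_eventuallyEq h))
  simp only [_root_.add_apply, ContinuousLinearMap.comp_apply,
    ContinuousLinearMap.flip_apply, ContinuousLinearMap.prod_apply,
    _root_.zero_apply, map_zero, zero_add, hid, hfe, ContinuousLinearMap.inl_apply,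
    ContinuousLinearMap.inr_apply] at h3
  rw [lieBracket_eq]
  simp only [hid, hLv]
  rw [hsymm.eq (Y, 0) (0, X), ← hD, h3]
  abel

end Calculus

section LieGroup

variable {E : Type*} [NormedAddCommGroup E] [NormedSpace ℝ E]
  {H : Type*} [TopologicalSpace H] (I : ModelWithCorners ℝ E H)
  {G : Type*} [TopologicalSpace G] [ChartedSpace H G] [Group G] [LieGroup I ∞ G]

theorem contMDiff_Ad : ContMDiff I 𝓘(ℝ, GroupLieAlgebra I G →L[ℝ] GroupLieAlgebra I G) ∞
    (fun x : G => Ad I x) := by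
  have : IsManifold I 1 G := IsManifold.of_le (n := ∞) (by simp)
  intro x₀
  have h := ContMDiffAt.mfderiv (I := I) (I' := I) (J := I) (n := ∞) (m := ∞) (x₀ := x₀)
    (fun (x : G) (y : G) => x * y * x⁻¹) (fun _ => (1 : G))
    (by
      apply ContMDiff.contMDiffAt
      exact (contMDiff_fst.mul contMDiff_snd).mul contMDiff_fst.inv)
    contMDiffAt_const (by simp)
  have h2 : inTangentCoordinates I I (fun _ : G => (1 : G)) (fun x : G => x * 1 * x⁻¹)
      (fun x => mfderiv I I (fun y : G => x * y * x⁻¹) 1) x₀ = fun x => Ad I x := by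
    funext x
    rw [inTangentCoordinates_eq_mfderiv_comp (by simp) (by simp)]
    have e1 : mfderiv I 𝓘(ℝ, E) (extChartAt I (x₀ * 1 * x₀⁻¹)) (x * 1 * x⁻¹) =
        ContinuousLinearMap.id ℝ E := by
      have : x * 1 * x⁻¹ = x₀ * 1 * x₀⁻¹ := by simp
      rw [this]
      exact mfderiv_extChartAt_self
    have e2 : mfderivWithin 𝓘(ℝ, E) I (extChartAt I (1 : G)).symm (range I)
        (extChartAt I (1 : G) 1) = ContinuousLinearMap.id ℝ E :=
      mfderivWithin_range_extChartAt_symm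
    rw [e2]
    erw [e1]
    rfl
  rw [h2] at h
  exact h

theorem contMDiff_Ad_apply {N EN HN : Type*} [NormedAddCommGroup EN] [NormedSpace ℝ EN]
    [TopologicalSpace HN] {J : ModelWithCorners ℝ EN HN} [TopologicalSpace N] [ChartedSpace HN N]
    {g : N → G} {Y : N → GroupLieAlgebra I G} (hg : ContMDiff J I ∞ g)
    (hY : ContMDiff J 𝓘(ℝ, GroupLieAlgebra I G) ∞ Y) :
    ContMDiff J 𝓘(ℝ, GroupLieAlgebra I G) ∞ (fun n => Ad I (g n) (Y n)) :=
  ((contMDiff_Ad I).comp hg).clm_apply hY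

section DerivAd

variable [I.Boundaryless]

theorem hasMFDerivAt_extChartAt_symm {M : Type*} [TopologicalSpace M] [ChartedSpace H M]
    [IsManifold I 1 M] {x : M} {a : E}
    (ha : a ∈ (extChartAt I x).target) :
    HasMFDerivAt 𝓘(ℝ, E) I (extChartAt I x).symm a
      (mfderivWithin 𝓘(ℝ, E) I (extChartAt I x).symm (range I) a) := by
  have h := (mdifferentiableWithinAt_extChartAt_symm (I := I) ha).hasMFDerivWithinAt
  have hr : range I = univ := I.range_eq_univ
  rw [hr] at h ⊢
  exact hasMFDerivWithinAt_univ.1 h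

theorem hasMFDerivAt_extChartAt_symm_self {M : Type*} [TopologicalSpace M] [ChartedSpace H M]
    [IsManifold I 1 M] (x : M) :
    HasMFDerivAt 𝓘(ℝ, E) I (extChartAt I x).symm (extChartAt I x x)
      (ContinuousLinearMap.id ℝ E) := by
  have h := hasMFDerivAt_extChartAt_symm I (mem_extChartAt_target (I := I) x)
  rw [mfderivWithin_range_extChartAt_symm] at h
  exact h

variable (G) in
/-- The multiplication of `G` in the chart at `1`. -/
def chartMul (p : E × E) : E :=
  extChartAt I (1 : G) ((extChartAt I (1 : G)).symm p.1 * (extChartAt I (1 : G)).symm p.2)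

theorem contDiffAt_chartMul :
    ContDiffAt ℝ ∞ (chartMul I G) (extChartAt I (1 : G) 1, extChartAt I (1 : G) 1) := by
  rw [← contMDiffAt_iff_contDiffAt]
  have hs : ContMDiffAt 𝓘(ℝ, E) I ∞ (extChartAt I (1 : G)).symm (extChartAt I (1 : G) 1) :=
    (contMDiffOn_extChartAt_symm (1 : G)).contMDiffAt (extChartAt_target_mem_nhds (1 : G))
  have h1 : ContMDiffAt 𝓘(ℝ, E × E) I ∞ (fun p : E × E => (extChartAt I (1 : G)).symm p.1)
      (extChartAt I (1 : G) 1, extChartAt I (1 : G) 1) :=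
    hs.comp (extChartAt I (1 : G) 1, extChartAt I (1 : G) 1) contDiff_fst.contMDiff.contMDiffAt
  have h2 : ContMDiffAt 𝓘(ℝ, E × E) I ∞ (fun p : E × E => (extChartAt I (1 : G)).symm p.2)
      (extChartAt I (1 : G) 1, extChartAt I (1 : G) 1) :=
    hs.comp (extChartAt I (1 : G) 1, extChartAt I (1 : G) 1) contDiff_snd.contMDiff.contMDiffAt
  have h3 := h1.mul h2
  refine ContMDiffAt.comp (I' := I) _ ?_ h3
  have : (1 : G) * 1 = 1 := mul_one 1
  simp only [extChartAt_to_inv, this]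
  exact contMDiffAt_extChartAt

theorem eventually_fderiv_chartMul_left :
    ∀ᶠ a in 𝓝 (extChartAt I (1 : G) 1), ∀ v : GroupLieAlgebra I G,
      fderiv ℝ (chartMul I G) (a, extChartAt I (1 : G) 1) ((0 : E), (v : E)) =
        mfderiv I 𝓘(ℝ, E) (extChartAt I (1 : G)) ((extChartAt I (1 : G)).symm a)
          (mulInvariantVectorField v ((extChartAt I (1 : G)).symm a)) := by
  have : IsManifold I 1 G := IsManifold.of_le (n := ∞) (by simp)
  set e := extChartAt I (1 : G) 1 with he
  have hc : ∀ᶠ p in 𝓝 (e, e), DifferentiableAt ℝ (chartMul I G) p :=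
    (((contDiffAt_chartMul I (G := G)).of_le (m := 1) (by simp)).eventually (by simp)).mono
      fun p hp => hp.differentiableAt (by simp)
  have hc' : ∀ᶠ a in 𝓝 e, DifferentiableAt ℝ (chartMul I G) (a, e) :=
    (Continuous.prodMk_left e).continuousAt.eventually hc
  filter_upwards [hc', extChartAt_target_mem_nhds (I := I) (1 : G)] with a ha hat v
  set x := (extChartAt I (1 : G)).symm a with hx
  have hxs : x ∈ (chartAt H (1 : G)).source := by
    rw [← extChartAt_source I]; exact (extChartAt I (1 : G)).map_target hat
  have h1 : HasFDerivAt (fun b => chartMul I G (a, b))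
      ((fderiv ℝ (chartMul I G) (a, e)).comp (ContinuousLinearMap.inr ℝ E E)) e :=
    HasFDerivAt.comp (g := chartMul I G) e ha.hasFDerivAt (hasFDerivAt_prodMk_right a e)
  have h2 : HasMFDerivAt 𝓘(ℝ, E) I (extChartAt I (1 : G)).symm e (ContinuousLinearMap.id ℝ E) :=
    hasMFDerivAt_extChartAt_symm_self I 1
  have h3 : HasMFDerivAt I I (fun y : G => x * y) ((extChartAt I (1 : G)).symm e)
      (mfderiv I I (fun y : G => x * y) 1) := by
    rw [he, extChartAt_to_inv]
    exact ((contMDiff_mul_left (a := x)).mdifferentiable (n := ∞) (by simp) 1).hasMFDerivAt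
  have h4 : HasMFDerivAt I 𝓘(ℝ, E) (extChartAt I (1 : G)) (x * (extChartAt I (1 : G)).symm e)
      (mfderiv I 𝓘(ℝ, E) (extChartAt I (1 : G)) x) := by
    rw [he, extChartAt_to_inv, mul_one]
    exact (mdifferentiableAt_extChartAt hxs).hasMFDerivAt
  have h5 := (HasMFDerivAt.comp e h4 (HasMFDerivAt.comp e h3 h2)).hasFDerivAt
  have h6 := h1.unique h5
  exact congrArg (fun A : E →L[ℝ] E => A v) h6

theorem eventually_fderiv_chartMul_right :
    ∀ᶠ a in 𝓝 (extChartAt I (1 : G) 1), ∀ v : GroupLieAlgebra I G,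
      fderiv ℝ (chartMul I G) (extChartAt I (1 : G) 1, a) ((v : E), (0 : E)) =
        mfderiv I 𝓘(ℝ, E) (extChartAt I (1 : G)) ((extChartAt I (1 : G)).symm a)
          (mulInvariantVectorField (Ad I ((extChartAt I (1 : G)).symm a)⁻¹ v)
            ((extChartAt I (1 : G)).symm a)) := by
  have : IsManifold I 1 G := IsManifold.of_le (n := ∞) (by simp)
  set e := extChartAt I (1 : G) 1 with he
  have hc : ∀ᶠ p in 𝓝 (e, e), DifferentiableAt ℝ (chartMul I G) p :=
    (((contDiffAt_chartMul I (G := G)).of_le (m := 1) (by simp)).eventually (by simp)).mono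
      fun p hp => hp.differentiableAt (by simp)
  have hc' : ∀ᶠ a in 𝓝 e, DifferentiableAt ℝ (chartMul I G) (e, a) :=
    (Continuous.prodMk_right e).continuousAt.eventually hc
  filter_upwards [hc', extChartAt_target_mem_nhds (I := I) (1 : G)] with a ha hat v
  set x := (extChartAt I (1 : G)).symm a with hx
  have hxs : x ∈ (chartAt H (1 : G)).source := by
    rw [← extChartAt_source I]; exact (extChartAt I (1 : G)).map_target hat
  have h1 : HasFDerivAt (fun b => chartMul I G (b, a))
      ((fderiv ℝ (chartMul I G) (e, a)).comp (ContinuousLinearMap.inl ℝ E E)) e :=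
    HasFDerivAt.comp (g := chartMul I G) e ha.hasFDerivAt (hasFDerivAt_prodMk_left e a)
  have h2 : HasMFDerivAt 𝓘(ℝ, E) I (extChartAt I (1 : G)).symm e (ContinuousLinearMap.id ℝ E) :=
    hasMFDerivAt_extChartAt_symm_self I 1
  have h3 : HasMFDerivAt I I (fun y : G => x * (x⁻¹ * y * x⁻¹⁻¹))
      ((extChartAt I (1 : G)).symm e)
      ((mfderiv I I (fun y : G => x * y) 1).comp (Ad I x⁻¹)) := by
    rw [he, extChartAt_to_inv]
    have h31 : HasMFDerivAt I I (fun y : G => x * y) (x⁻¹ * 1 * x⁻¹⁻¹)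
        (mfderiv I I (fun y : G => x * y) 1) := by
      have h : x⁻¹ * 1 * x⁻¹⁻¹ = 1 := by simp
      rw [h]
      exact ((contMDiff_mul_left (a := x)).mdifferentiable (n := ∞) (by simp) 1).hasMFDerivAt
    exact HasMFDerivAt.comp 1 h31 (mdifferentiable_conj I x⁻¹ 1).hasMFDerivAt
  have h4 : HasMFDerivAt I 𝓘(ℝ, E) (extChartAt I (1 : G))
      (x * (x⁻¹ * (extChartAt I (1 : G)).symm e * x⁻¹⁻¹))
      (mfderiv I 𝓘(ℝ, E) (extChartAt I (1 : G)) x) := by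
    have h : x * (x⁻¹ * (1 : G) * x⁻¹⁻¹) = x := by simp
    rw [he, extChartAt_to_inv, h]
    exact (mdifferentiableAt_extChartAt hxs).hasMFDerivAt
  have h5 := (HasMFDerivAt.comp e h4 (HasMFDerivAt.comp e h3 h2)).hasFDerivAt
  have h7 : (fun b => chartMul I G (b, a)) =
      extChartAt I (1 : G) ∘ (fun y : G => x * (x⁻¹ * y * x⁻¹⁻¹)) ∘ (extChartAt I (1 : G)).symm := by
    funext b
    simp only [chartMul, Function.comp_apply, ← hx]
    congr 1
    group
  rw [h7] at h1
  have h6 := h1.unique h5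
  exact congrArg (fun A : E →L[ℝ] E => A v) h6

omit [I.Boundaryless] in
theorem mpullbackWithin_extChartAt_symm_apply {M : Type*} [TopologicalSpace M] [ChartedSpace H M]
    [IsManifold I 1 M] [CompleteSpace E] {x : M} (V : (y : M) → TangentSpace I y) {a : E}
    (ha : a ∈ (extChartAt I x).target) :
    mpullbackWithin 𝓘(ℝ, E) I (extChartAt I x).symm V (range I) a =
      mfderiv I 𝓘(ℝ, E) (extChartAt I x) ((extChartAt I x).symm a)
        (V ((extChartAt I x).symm a)) := by
  rw [mpullbackWithin_apply]
  congr 1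
  refine ContinuousLinearMap.inverse_eq ?_ ?_
  · exact mfderivWithin_extChartAt_symm_comp_mfderiv_extChartAt ha
  · exact mfderiv_extChartAt_comp_mfderivWithin_extChartAt_symm ha

theorem mlieBracket_eq_lieBracket {M : Type*} [TopologicalSpace M] [ChartedSpace H M]
    [IsManifold I 1 M] (V W : (y : M) → TangentSpace I y) (x : M) :
    mlieBracket I V W x = (lieBracket ℝ
      (mpullbackWithin 𝓘(ℝ, E) I (extChartAt I x).symm V (range I))
      (mpullbackWithin 𝓘(ℝ, E) I (extChartAt I x).symm W (range I)) (extChartAt I x x) : E) := by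
  have hr : range I = univ := I.range_eq_univ
  have h : (mfderiv I 𝓘(ℝ, E) (extChartAt I x) x : E →L[ℝ] E) = ContinuousLinearMap.id ℝ E :=
    mfderiv_extChartAt_self
  rw [← mlieBracketWithin_univ, mlieBracketWithin_apply, preimage_univ, univ_inter]
  let A : E →L[ℝ] E :=
    ContinuousLinearMap.inverse (mfderiv I 𝓘(ℝ, E) (extChartAt I x) x : E →L[ℝ] E)
  change A _ = _
  simp only [A]
  rw [h, ContinuousLinearMap.inverse_id, hr]
  exact congrFun (lieBracketWithin_univ (E := E)) _

variable [FiniteDimensional ℝ E]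

/-- The derivative of `g ↦ Ad_{g⁻¹} Y` at `1` is `X ↦ ⁅Y, X⁆`. -/
theorem mfderiv_Ad_inv_apply (X Y : GroupLieAlgebra I G) :
    mfderiv I 𝓘(ℝ, GroupLieAlgebra I G) (fun g : G => Ad I g⁻¹ Y) 1 X = ⁅Y, X⁆ := by
  have : IsManifold I 1 G := IsManifold.of_le (n := ∞) (by simp)
  have : CompleteSpace E := FiniteDimensional.complete ℝ E
  have hs : ContMDiff I 𝓘(ℝ, GroupLieAlgebra I G) ∞ (fun g : G => Ad I g⁻¹ Y) :=
    contMDiff_Ad_apply I (contMDiff_inv I ∞) contMDiff_const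
  set e : E := extChartAt I (1 : G) 1 with he
  let f : E → E := fun a => Ad I ((extChartAt I (1 : G)).symm a)⁻¹ Y
  let T : E →L[ℝ] E := mfderiv I 𝓘(ℝ, GroupLieAlgebra I G) (fun g : G => Ad I g⁻¹ Y) 1
  have hf : HasFDerivAt f T e := by
    have h1 : HasMFDerivAt I 𝓘(ℝ, GroupLieAlgebra I G) (fun g : G => Ad I g⁻¹ Y)
        ((extChartAt I (1 : G)).symm e)
        (mfderiv I 𝓘(ℝ, GroupLieAlgebra I G) (fun g : G => Ad I g⁻¹ Y) 1) := by
      rw [he, extChartAt_to_inv]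
      exact (hs.mdifferentiable (by simp) 1).hasMFDerivAt
    have h2 := (HasMFDerivAt.comp e h1 (hasMFDerivAt_extChartAt_symm_self I (1 : G))).hasFDerivAt
    exact h2
  have hfe : f e = Y := by
    simp only [f]
    rw [he, extChartAt_to_inv, inv_one, Ad_one]; rfl
  have hl := eventually_fderiv_chartMul_left I (G := G)
  have hid : ∀ v, fderiv ℝ (chartMul I G) (e, e) (0, v) = v := by
    intro v
    have h := hl.self_of_nhds v
    rw [extChartAt_to_inv, mfderiv_extChartAt_self] at h
    rw [he, h]
    have h2 : mfderiv I I (fun y : G => 1 * y) 1 = ContinuousLinearMap.id ℝ E := by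
      have : (fun y : G => 1 * y) = id := by ext y; simp
      rw [this]
      exact mfderiv_id
    exact congrArg (fun A : E →L[ℝ] E => A v) h2
  have h := fderiv_eq_lieBracket_of_partial_eq (E := E) (X := X) (Y := Y)
    ((contDiffAt_chartMul I (G := G)).of_le
      (WithTop.coe_le_coe.2 (le_top : (2 : ℕ∞) ≤ ⊤))) hf.differentiableAt hfe hid
    (by
      filter_upwards [hl, eventually_fderiv_chartMul_right I (G := G)] with a h1 h2
      exact (h2 Y).trans (h1 _).symm)
  refine (congrArg (fun A : E →L[ℝ] E => A X) hf.fderiv).symm.trans (h.trans ?_)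
  rw [GroupLieAlgebra.bracket_def, mlieBracket_eq_lieBracket]
  have hV : ∀ v : GroupLieAlgebra I G, (fun a => fderiv ℝ (chartMul I G) (a, e) ((0 : E), (v : E)))
      =ᶠ[𝓝 e] mpullbackWithin 𝓘(ℝ, E) I (extChartAt I (1 : G)).symm (mulInvariantVectorField v)
        (range I) := by
    intro v
    filter_upwards [hl, extChartAt_target_mem_nhds (I := I) (1 : G)] with a ha hat
    rw [ha v, mpullbackWithin_extChartAt_symm_apply I _ hat]
  exact (hV Y).lieBracket_vectorField_eq (hV X)

end DerivAd

end LieGroup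

section Semidirect

variable {E : Type*} [NormedAddCommGroup E] [NormedSpace ℝ E]
  {H : Type*} [TopologicalSpace H] (I : ModelWithCorners ℝ E H)
  {G : Type*} [TopologicalSpace G] [ChartedSpace H G] [Group G] [LieGroup I ∞ G]

variable {N EN HN : Type*} [NormedAddCommGroup EN] [NormedSpace ℝ EN]
    [TopologicalSpace HN] {J : ModelWithCorners ℝ EN HN} [TopologicalSpace N] [ChartedSpace HN N]

theorem contMDiff_semidirect_mul {f g : N → G × GroupLieAlgebra I G}
    (hf : ContMDiff J (semiModel I G) ∞ f) (hg : ContMDiff J (semiModel I G) ∞ g) :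
    ContMDiff J (semiModel I G) ∞ (fun n => f n * g n) :=
  (hf.fst.mul hg.fst).prodMk ((contMDiff_Ad_apply I hg.fst.inv hf.snd).add hg.snd)

theorem contMDiff_semidirect_inv {f : N → G × GroupLieAlgebra I G}
    (hf : ContMDiff J (semiModel I G) ∞ f) :
    ContMDiff J (semiModel I G) ∞ (fun n => (f n)⁻¹) :=
  hf.fst.inv.prodMk (contMDiff_Ad_apply I hf.fst hf.snd).neg

theorem mdifferentiable_semidirect_mul_left (p : G × GroupLieAlgebra I G) :
    MDifferentiable (semiModel I G) (semiModel I G) (fun q => p * q) :=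
  (contMDiff_semidirect_mul I contMDiff_const contMDiff_id).mdifferentiable (by simp)

theorem semiLeftInv_semiLeft (p : G × GroupLieAlgebra I G)
    (v : TangentSpace (semiModel I G) (1 : G × GroupLieAlgebra I G)) :
    semiLeftInv I p (semiLeft I p v) = v := by
  have h1 : HasMFDerivAt (semiModel I G) (semiModel I G)
      (fun q : G × GroupLieAlgebra I G => p⁻¹ * q) (p * 1) (semiLeftInv I p) := by
    rw [mul_one]
    exact (mdifferentiable_semidirect_mul_left I p⁻¹ p).hasMFDerivAt
  have h2 := HasMFDerivAt.comp 1 h1 (mdifferentiable_semidirect_mul_left I p 1).hasMFDerivAt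
  have h3 : (fun q : G × GroupLieAlgebra I G => p⁻¹ * q) ∘ (fun q => p * q) = id := by
    funext q; simp
  rw [h3] at h2
  exact congrArg (fun A : (E × GroupLieAlgebra I G) →L[ℝ] (E × GroupLieAlgebra I G) => A v)
    (hasMFDerivAt_unique h2 (hasMFDerivAt_id _))

theorem semiLeft_semiLeftInv (p : G × GroupLieAlgebra I G) (v : TangentSpace (semiModel I G) p) :
    semiLeft I p (semiLeftInv I p v) = v := by
  have h1 : HasMFDerivAt (semiModel I G) (semiModel I G)
      (fun q : G × GroupLieAlgebra I G => p * q) (p⁻¹ * p) (semiLeft I p) := by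
    rw [inv_mul_cancel]
    exact (mdifferentiable_semidirect_mul_left I p 1).hasMFDerivAt
  have h2 := HasMFDerivAt.comp p h1 (mdifferentiable_semidirect_mul_left I p⁻¹ p).hasMFDerivAt
  have h3 : (fun q : G × GroupLieAlgebra I G => p * q) ∘ (fun q => p⁻¹ * q) = id := by
    funext q; simp
  rw [h3] at h2
  exact congrArg (fun A : (E × GroupLieAlgebra I G) →L[ℝ] (E × GroupLieAlgebra I G) => A v)
    (hasMFDerivAt_unique h2 (hasMFDerivAt_id _))

theorem leftTriv_leftTrivInv (z : Phase I G) : leftTriv I (leftTrivInv I z) = z := by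
  obtain ⟨x, Y, μ, ξ⟩ := z
  refine Prod.ext rfl (Prod.ext rfl (Prod.ext ?_ ?_))
  · ext X
    change (μ.coprod ξ) (semiLeftInv I (x, Y) (semiLeft I (x, Y) (X, 0))) = μ X
    refine (congrArg (μ.coprod ξ) (semiLeftInv_semiLeft I (x, Y) (X, 0))).trans ?_
    change μ X + ξ 0 = μ X
    simp
  · ext Z
    change (μ.coprod ξ) (semiLeftInv I (x, Y) (semiLeft I (x, Y) (0, Z))) = ξ Z
    refine (congrArg (μ.coprod ξ) (semiLeftInv_semiLeft I (x, Y) (0, Z))).trans ?_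
    change μ 0 + ξ Z = ξ Z
    simp

theorem leftTrivInv_leftTriv (α : CotSemi I G) : leftTrivInv I (leftTriv I α) = α := by
  obtain ⟨p, α⟩ := α
  refine congrArg (TotalSpace.mk p) ?_
  ext v
  set w : GroupLieAlgebra I G × GroupLieAlgebra I G := semiLeftInv I p v with hw
  let β : GroupLieAlgebra I G × GroupLieAlgebra I G →L[ℝ] ℝ := α.comp (semiLeft I p)
  change β (w.1, 0) + β (0, w.2) = α v
  rw [← map_add]
  have h : ((w.1, 0) + (0, w.2) : GroupLieAlgebra I G × GroupLieAlgebra I G) = w := by simp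
  rw [h]
  exact congrArg α (semiLeft_semiLeftInv I p v)

variable [I.Boundaryless] [FiniteDimensional ℝ E]

theorem semiLeft_apply (p : G × GroupLieAlgebra I G) (X Z : GroupLieAlgebra I G) :
    semiLeft I p (semiTangent I 1 (X, Z)) =
      semiTangent I p (mulInvariantVectorField X p.1, ⁅p.2, X⁆ + Z) := by
  have h1 : HasMFDerivAt (semiModel I G) I (fun q : G × GroupLieAlgebra I G => p.1 * q.1) 1
      ((mfderiv I I (fun y : G => p.1 * y) 1).comp
        (ContinuousLinearMap.fst ℝ E (GroupLieAlgebra I G))) :=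
    HasMFDerivAt.comp (g := fun y : G => p.1 * y) (1 : G × GroupLieAlgebra I G)
      ((contMDiff_mul_left (a := p.1)).mdifferentiable (n := ∞) (by simp) 1).hasMFDerivAt
      (hasMFDerivAt_fst 1)
  have hs : ContMDiff I 𝓘(ℝ, GroupLieAlgebra I G) ∞ (fun g : G => Ad I g⁻¹ p.2) :=
    contMDiff_Ad_apply I (contMDiff_inv I ∞) contMDiff_const
  have h2 : HasMFDerivAt (semiModel I G) 𝓘(ℝ, GroupLieAlgebra I G)
      (fun q : G × GroupLieAlgebra I G => Ad I q.1⁻¹ p.2) 1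
      ((mfderiv I 𝓘(ℝ, GroupLieAlgebra I G) (fun g : G => Ad I g⁻¹ p.2) 1).comp
        (ContinuousLinearMap.fst ℝ E (GroupLieAlgebra I G))) :=
    HasMFDerivAt.comp (g := fun g : G => Ad I g⁻¹ p.2) (1 : G × GroupLieAlgebra I G)
      (hs.mdifferentiable (by simp) 1).hasMFDerivAt (hasMFDerivAt_fst 1)
  have h3 := h2.add (hasMFDerivAt_snd (I := I) (I' := 𝓘(ℝ, GroupLieAlgebra I G))
    (1 : G × GroupLieAlgebra I G))
  have h4 := (h1.prodMk h3).mfderiv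
  have h5 := congrArg (fun A : (E × GroupLieAlgebra I G) →L[ℝ] (E × GroupLieAlgebra I G) =>
    A (X, Z)) h4
  refine h5.trans ?_
  refine Prod.ext rfl ?_
  exact congrArg (fun v : GroupLieAlgebra I G => v + Z) (mfderiv_Ad_inv_apply I X p.2)

theorem semiLeftInv_apply (p : G × GroupLieAlgebra I G) (X Z : GroupLieAlgebra I G) :
    semiLeftInv I p (semiTangent I p (mulInvariantVectorField X p.1, Z)) =
      semiTangent I 1 (X, Z - ⁅p.2, X⁆) := by
  have h := semiLeft_apply I p X (Z - ⁅p.2, X⁆)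
  rw [add_sub_cancel] at h
  rw [← h, semiLeftInv_semiLeft]

theorem hamCot_leftTrivInv (m : Metric I G) (z : Phase I G) :
    hamCot I m (leftTrivInv I z) = ham I m z := by
  obtain ⟨x, Y, μ, ξ⟩ := z
  have h1 : ∀ Z : GroupLieAlgebra I G, (μ.coprod ξ) ((semiTangent I
      (1 : G × GroupLieAlgebra I G)).symm (semiLeftInv I (x, Y) (semiTangent I (x, Y) (0, Z))))
      = ξ Z := by
    intro Z
    have h := semiLeftInv_apply I (x, Y) 0 Z
    have h0 : (mulInvariantVectorField (0 : GroupLieAlgebra I G) x) = 0 := map_zero _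
    simp only [h0, lie_zero, sub_zero] at h
    rw [h, ContinuousLinearEquiv.symm_apply_apply]
    simp
  have h2 : (μ.coprod ξ) ((semiTangent I (1 : G × GroupLieAlgebra I G)).symm (semiLeftInv I (x, Y)
      (semiTangent I (x, Y) (mulInvariantVectorField Y x, 0)))) = μ Y := by
    rw [semiLeftInv_apply I (x, Y) Y 0, ContinuousLinearEquiv.symm_apply_apply]
    simp
  let b : TangentSpace I x × GroupLieAlgebra I G →L[ℝ] ℝ := (leftTrivInv I (x, Y, μ, ξ)).2.comp
      (semiTangent I (x, Y) : _ →L[ℝ] TangentSpace (semiModel I G) (x, Y))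
  have h3 : b.comp (ContinuousLinearMap.inr ℝ _ _) = ξ := by
    ext Z; exact h1 Z
  change b (mulInvariantVectorField Y x, 0) + 1 / 2 * (b.comp (ContinuousLinearMap.inr ℝ _ _))
    (sharp I m (b.comp (ContinuousLinearMap.inr ℝ _ _))) = μ Y + 1 / 2 * ξ (sharp I m ξ)
  rw [h3]
  exact congrArg (fun r : ℝ => r + 1 / 2 * ξ (sharp I m ξ)) h2

end Semidirect

section CotangentBundle

variable {E : Type*} [NormedAddCommGroup E] [NormedSpace ℝ E]
  {H : Type*} [TopologicalSpace H] (I : ModelWithCorners ℝ E H)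
  {M : Type*} [TopologicalSpace M] [ChartedSpace H M] [IsManifold I 1 M]
  {N EN HN : Type*} [NormedAddCommGroup EN] [NormedSpace ℝ EN]
  [TopologicalSpace HN] {J : ModelWithCorners ℝ EN HN} [TopologicalSpace N] [ChartedSpace HN N]

/-- A covector at `x` expressed in the chart at `x₀`. -/
def covectorInChart (x₀ : M) (α : Cotangent I M) : E →L[ℝ] ℝ :=
  α.2.comp (mfderivWithin 𝓘(ℝ, E) I (extChartAt I x₀).symm (range I) (extChartAt I x₀ α.1))

theorem inCoordinates_cotangent {x₀ x : M} (hx : x ∈ (chartAt H x₀).source)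
    (α : TangentSpace I x →L[ℝ] ℝ) :
    ContinuousLinearMap.inCoordinates E (TangentSpace I) ℝ (fun _ : M => ℝ) x₀ x x₀ x α =
      covectorInChart I x₀ ⟨x, α⟩ := by
  rw [ContinuousLinearMap.inCoordinates, TangentBundle.symmL_trivializationAt hx]
  ext v
  simp [covectorInChart]

theorem contMDiffAt_cotangent_iff {n : ℕ∞ω} {f : N → Cotangent I M} {a : N} :
    ContMDiffAt J (cotangentModel I) n f a ↔ ContMDiffAt J I n (fun b => (f b).1) a ∧
      ContMDiffAt J 𝓘(ℝ, E →L[ℝ] ℝ) n (fun b => covectorInChart I (f a).1 (f b)) a := by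
  rw [contMDiffAt_hom_bundle]
  refine and_congr_right fun h => ?_
  have hs : ∀ᶠ b in 𝓝 a, (f b).1 ∈ (chartAt H (f a).1).source :=
    h.continuousAt.eventually (chart_source_mem_nhds H (f a).1)
  refine Filter.EventuallyEq.contMDiffAt_iff ?_
  filter_upwards [hs] with b hb
  exact inCoordinates_cotangent I hb _

end CotangentBundle

section Semidirect

variable {E : Type*} [NormedAddCommGroup E] [NormedSpace ℝ E]
  {H : Type*} [TopologicalSpace H] (I : ModelWithCorners ℝ E H)
  {G : Type*} [TopologicalSpace G] [ChartedSpace H G] [Group G] [LieGroup I ∞ G]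

/-- The derivative of the left translation by `p`, with values in the chart at `p₀`. -/
def semiLeftInChart (p₀ p : G × GroupLieAlgebra I G) :
    (E × GroupLieAlgebra I G) →L[ℝ] (E × GroupLieAlgebra I G) :=
  (mfderiv (semiModel I G) 𝓘(ℝ, E × GroupLieAlgebra I G) (extChartAt (semiModel I G) p₀) p).comp
    (semiLeft I p)

/-- The derivative of the left translation by `p⁻¹` on vectors at `p` in the chart at `p₀`. -/
def semiLeftInvInChart (p₀ p : G × GroupLieAlgebra I G) :
    (E × GroupLieAlgebra I G) →L[ℝ] (E × GroupLieAlgebra I G) :=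
  (semiLeftInv I p).comp (mfderivWithin 𝓘(ℝ, E × GroupLieAlgebra I G) (semiModel I G)
    (extChartAt (semiModel I G) p₀).symm (range (semiModel I G)) (extChartAt (semiModel I G) p₀ p))

/-- The pairing of `(μ, ξ)` with tangent vectors. -/
def pairing (μ ξ : LieDual I G) : (E × GroupLieAlgebra I G) →L[ℝ] ℝ :=
  (μ : E →L[ℝ] ℝ).comp (ContinuousLinearMap.fst ℝ E (GroupLieAlgebra I G)) +
    ξ.comp (ContinuousLinearMap.snd ℝ E (GroupLieAlgebra I G))

theorem contMDiffAt_semiLeftInChart (p₀ : G × GroupLieAlgebra I G) :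
    ContMDiffAt (semiModel I G)
      𝓘(ℝ, (E × GroupLieAlgebra I G) →L[ℝ] (E × GroupLieAlgebra I G)) ∞
      (semiLeftInChart I p₀) p₀ := by
  have h := ContMDiffAt.mfderiv (I := semiModel I G) (I' := semiModel I G) (J := semiModel I G)
    (n := ∞) (m := ∞) (x₀ := p₀)
    (fun p q : G × GroupLieAlgebra I G => p * q) (fun _ => (1 : G × GroupLieAlgebra I G))
    (contMDiff_semidirect_mul I contMDiff_fst contMDiff_snd).contMDiffAt
    contMDiffAt_const (by simp)
  refine h.congr_of_eventuallyEq ?_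
  filter_upwards [chart_source_mem_nhds (ModelProd H (GroupLieAlgebra I G)) p₀] with p hp
  refine Eq.trans ?_ (inTangentCoordinates_eq_mfderiv_comp (I := semiModel I G)
    (I' := semiModel I G) (f := fun _ : G × GroupLieAlgebra I G => (1 : G × GroupLieAlgebra I G))
    (g := fun p : G × GroupLieAlgebra I G => p * 1) (ϕ := fun p => semiLeft I p)
    (mem_chart_source _ _) (by simpa using hp)).symm
  have e2 : mfderivWithin 𝓘(ℝ, E × GroupLieAlgebra I G) (semiModel I G)
      (extChartAt (semiModel I G) (1 : G × GroupLieAlgebra I G)).symm (range (semiModel I G))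
        (extChartAt (semiModel I G) (1 : G × GroupLieAlgebra I G) 1) =
        ContinuousLinearMap.id ℝ (E × GroupLieAlgebra I G) :=
    mfderivWithin_range_extChartAt_symm
  have e3 : (mfderiv (semiModel I G) 𝓘(ℝ, E × GroupLieAlgebra I G)
      (extChartAt (semiModel I G) (p₀ * 1)) (p * 1) :
      (E × GroupLieAlgebra I G) →L[ℝ] (E × GroupLieAlgebra I G)) =
      mfderiv (semiModel I G) 𝓘(ℝ, E × GroupLieAlgebra I G) (extChartAt (semiModel I G) p₀) p := by
    rw [mul_one, mul_one]
  rw [e2]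
  erw [e3]
  rfl

theorem contMDiffAt_semiLeftInvInChart (p₀ : G × GroupLieAlgebra I G) :
    ContMDiffAt (semiModel I G)
      𝓘(ℝ, (E × GroupLieAlgebra I G) →L[ℝ] (E × GroupLieAlgebra I G)) ∞
      (semiLeftInvInChart I p₀) p₀ := by
  have h := ContMDiffAt.mfderiv (I := semiModel I G) (I' := semiModel I G) (J := semiModel I G)
    (n := ∞) (m := ∞) (x₀ := p₀)
    (fun p q : G × GroupLieAlgebra I G => p⁻¹ * q) (fun p => p)
    (contMDiff_semidirect_mul I (contMDiff_semidirect_inv I contMDiff_fst)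
      contMDiff_snd).contMDiffAt
    contMDiffAt_id (by simp)
  refine h.congr_of_eventuallyEq ?_
  filter_upwards [chart_source_mem_nhds (ModelProd H (GroupLieAlgebra I G)) p₀] with p hp
  rw [inTangentCoordinates_eq_mfderiv_comp hp (by simp)]
  have e3 : (mfderiv (semiModel I G) 𝓘(ℝ, E × GroupLieAlgebra I G)
      (extChartAt (semiModel I G) (p₀⁻¹ * p₀)) (p⁻¹ * p) :
      (E × GroupLieAlgebra I G) →L[ℝ] (E × GroupLieAlgebra I G)) =
      ContinuousLinearMap.id ℝ (E × GroupLieAlgebra I G) := by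
    rw [inv_mul_cancel, inv_mul_cancel]
    exact mfderiv_extChartAt_self
  erw [e3]
  rfl

theorem contMDiff_leftTrivInv :
    ContMDiff (phaseModel I G) (cotangentModel (semiModel I G)) ∞
      (leftTrivInv I : Phase I G → CotSemi I G) := by
  intro z
  rw [contMDiffAt_cotangent_iff]
  have hb : ContMDiffAt (phaseModel I G) (semiModel I G) ∞ (fun w : Phase I G => (w.1, w.2.1)) z :=
    contMDiffAt_fst.prodMk contMDiffAt_snd.fst
  refine ⟨hb, ?_⟩
  have hμ : ContMDiffAt (phaseModel I G) 𝓘(ℝ, (E × GroupLieAlgebra I G) →L[ℝ] ℝ) ∞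
      (fun w : Phase I G => pairing I w.2.2.1 w.2.2.2) z := by
    have h0 : ContMDiffAt (phaseModel I G) 𝓘(ℝ, LieDual I G) ∞
      (fun w : Phase I G => w.2.2.1) z := contMDiffAt_snd.snd.fst
    have h1 : ContMDiffAt (M' := E →L[ℝ] ℝ) (phaseModel I G) 𝓘(ℝ, E →L[ℝ] ℝ) ∞
      (fun w : Phase I G => w.2.2.1) z := h0
    have h2 : ContMDiffAt (phaseModel I G) 𝓘(ℝ, LieDual I G) ∞
      (fun w : Phase I G => w.2.2.2) z := contMDiffAt_snd.snd.snd
    exact (h1.clm_comp contMDiffAt_const).add (h2.clm_comp contMDiffAt_const)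
  exact (hμ.clm_comp (ContMDiffAt.comp z (contMDiffAt_semiLeftInvInChart I (z.1, z.2.1)) hb):)

theorem contMDiff_leftTriv :
    ContMDiff (cotangentModel (semiModel I G)) (phaseModel I G) ∞
      (leftTriv I : CotSemi I G → Phase I G) := by
  intro α
  have h0 := (contMDiffAt_cotangent_iff (semiModel I G) (J := cotangentModel (semiModel I G))
    (n := ∞) (f := fun β : CotSemi I G => β) (a := α)).1 contMDiffAt_id
  have hm : ContMDiffAt (cotangentModel (semiModel I G)) 𝓘(ℝ, (E × GroupLieAlgebra I G) →L[ℝ] ℝ) ∞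
      (fun β : CotSemi I G => (β.2.comp (semiLeft I β.1) : (E × GroupLieAlgebra I G) →L[ℝ] ℝ)) α := by
    refine (h0.2.clm_comp (ContMDiffAt.comp α
      (contMDiffAt_semiLeftInChart I α.1) h0.1)).congr_of_eventuallyEq ?_
    filter_upwards [h0.1.continuousAt.eventually
      (chart_source_mem_nhds (ModelProd H (GroupLieAlgebra I G)) α.1)] with β hβ
    let A := mfderiv (semiModel I G) 𝓘(ℝ, E × GroupLieAlgebra I G)
      (extChartAt (semiModel I G) α.1) β.1
    let B := mfderivWithin 𝓘(ℝ, E × GroupLieAlgebra I G) (semiModel I G)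
      (extChartAt (semiModel I G) α.1).symm (range (semiModel I G))
      (extChartAt (semiModel I G) α.1 β.1)
    have h1 : B.comp A = ContinuousLinearMap.id ℝ (TangentSpace (semiModel I G) β.1) :=
      mfderivWithin_extChartAt_symm_comp_mfderiv_extChartAt' (by rwa [extChartAt_source])
    refine ContinuousLinearMap.ext fun v => ?_
    exact congrArg (fun T : TangentSpace (semiModel I G) β.1 →L[ℝ]
      TangentSpace (semiModel I G) β.1 => β.2 (T (semiLeft I β.1 v))) h1.symm
  have hl : ContMDiffAt (cotangentModel (semiModel I G)) 𝓘(ℝ, LieDual I G) ∞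
      (fun β : CotSemi I G => (leftTriv I β).2.2.1) α := by
    have h := hm.clm_comp (contMDiffAt_const (I := cotangentModel (semiModel I G))
      (c := ContinuousLinearMap.inl ℝ E (GroupLieAlgebra I G)))
    exact h
  have hr : ContMDiffAt (cotangentModel (semiModel I G)) 𝓘(ℝ, LieDual I G) ∞
      (fun β : CotSemi I G => (leftTriv I β).2.2.2) α := by
    have h := hm.clm_comp (contMDiffAt_const (I := cotangentModel (semiModel I G))
      (c := ContinuousLinearMap.inr ℝ E (GroupLieAlgebra I G)))
    exact h
  exact h0.1.fst.prodMk (h0.1.snd.prodMk (hl.prodMk hr))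

variable (G) in
/-- The left trivialization as a diffeomorphism. -/
def leftTrivDiffeomorph : Diffeomorph (cotangentModel (semiModel I G)) (phaseModel I G)
    (CotSemi I G) (Phase I G) ∞ where
  toFun := leftTriv I
  invFun := leftTrivInv I
  left_inv := leftTrivInv_leftTriv I
  right_inv := leftTriv_leftTrivInv I
  contMDiff_toFun := contMDiff_leftTriv I
  contMDiff_invFun := contMDiff_leftTrivInv I

end Semidirect

section PullbackForm

variable {E : Type*} [NormedAddCommGroup E] [NormedSpace ℝ E]
  {H : Type*} [TopologicalSpace H] (I : ModelWithCorners ℝ E H) [I.Boundaryless]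
  {M : Type*} [TopologicalSpace M] [ChartedSpace H M] [IsManifold I ∞ M]
  {E' : Type*} [NormedAddCommGroup E'] [NormedSpace ℝ E']
  {H' : Type*} [TopologicalSpace H'] (I' : ModelWithCorners ℝ E' H') [I'.Boundaryless]
  {M' : Type*} [TopologicalSpace M'] [ChartedSpace H' M'] [IsManifold I' ∞ M']

omit [I'.Boundaryless] in
/-- The derivative of a map expressed in charts. -/
theorem eventually_fderiv_inCharts {f : M → M'} (hf : ContMDiff I I' ∞ f) (p : M) :
    ∀ᶠ y in 𝓝 (extChartAt I p p), f ((extChartAt I p).symm y) ∈ (extChartAt I' (f p)).source ∧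
      ∀ v : E, fderiv ℝ (extChartAt I' (f p) ∘ f ∘ (extChartAt I p).symm) y v =
        mfderiv I' 𝓘(ℝ, E') (extChartAt I' (f p)) (f ((extChartAt I p).symm y))
          (mfderiv I I' f ((extChartAt I p).symm y)
            (mfderivWithin 𝓘(ℝ, E) I (extChartAt I p).symm (range I) y v)) := by
  have : IsManifold I 1 M := IsManifold.of_le (n := ∞) (by simp)
  have : IsManifold I' 1 M' := IsManifold.of_le (n := ∞) (by simp)
  have hc : ContinuousAt (fun y => f ((extChartAt I p).symm y)) (extChartAt I p p) :=
    ContinuousAt.comp (g := f) hf.continuous.continuousAt (continuousAt_extChartAt_symm p)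
  have hs : ∀ᶠ y in 𝓝 (extChartAt I p p),
      f ((extChartAt I p).symm y) ∈ (extChartAt I' (f p)).source :=
    hc.eventually (by simpa using extChartAt_source_mem_nhds (I := I') (f p))
  filter_upwards [hs, extChartAt_target_mem_nhds (I := I) p] with y hy hyt
  refine ⟨hy, ?_⟩
  have hy' : f ((extChartAt I p).symm y) ∈ (chartAt H' (f p)).source := by
    rwa [← extChartAt_source I']
  have h2 := (hf.mdifferentiable (by simp) ((extChartAt I p).symm y)).hasMFDerivAt
  have h3 := (mdifferentiableAt_extChartAt (I := I') hy').hasMFDerivAt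
  intro v
  have h4 := HasMFDerivAt.comp y h3 (HasMFDerivAt.comp y h2 (hasMFDerivAt_extChartAt_symm I hyt))
  let T : E →L[ℝ] E' := (mfderiv I' 𝓘(ℝ, E') (extChartAt I' (f p)) (f ((extChartAt I p).symm y))).comp
    ((mfderiv I I' f ((extChartAt I p).symm y)).comp
      (mfderivWithin 𝓘(ℝ, E) I (extChartAt I p).symm (range I) y))
  have h5 : HasFDerivAt (extChartAt I' (f p) ∘ f ∘ (extChartAt I p).symm) T y := h4.hasFDerivAt
  rw [h5.fderiv]
  rfl

omit [IsManifold I ∞ M] [I'.Boundaryless] [IsManifold I' ∞ M'] in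
theorem contDiffAt_inCharts {f : M → M'} (hf : ContMDiff I I' ∞ f) (p : M) :
    ContDiffAt ℝ ∞ (extChartAt I' (f p) ∘ f ∘ (extChartAt I p).symm) (extChartAt I p p) := by
  have h := (contMDiffAt_iff.1 (hf p)).2
  have hr : range I = univ := I.range_eq_univ
  rwa [hr, contDiffWithinAt_univ] at h

omit [I'.Boundaryless] in
theorem DiffForm.inChart_pullback_eventuallyEq {n : ℕ} {f : M → M'} (hf : ContMDiff I I' ∞ f)
    (η : DiffForm I' M' n) (p : M) :
    DiffForm.inChart I (DiffForm.pullback I I' f η) p =ᶠ[𝓝 (extChartAt I p p)]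
      fun y => (DiffForm.inChart I' η (f p)
        ((extChartAt I' (f p) ∘ f ∘ (extChartAt I p).symm) y)).compContinuousLinearMap
        (fderiv ℝ (extChartAt I' (f p) ∘ f ∘ (extChartAt I p).symm) y) := by
  have : IsManifold I' 1 M' := IsManifold.of_le (n := ∞) (by simp)
  filter_upwards [eventually_fderiv_inCharts I I' hf p] with y hy
  obtain ⟨hy, hd⟩ := hy
  set x := (extChartAt I p).symm y with hx
  have hB := mfderivWithin_extChartAt_symm_comp_mfderiv_extChartAt' (I := I') hy
  let η' : M' → E' [⋀^Fin n]→L[ℝ] ℝ := η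
  have h1 : η' ((extChartAt I' (f p)).symm (extChartAt I' (f p) (f x))) = η' (f x) := by
    rw [(extChartAt I' (f p)).left_inv hy]
  refine ContinuousAlternatingMap.ext fun v => ?_
  change η' (f x) (fun i => mfderiv I I' f x (mfderivWithin 𝓘(ℝ, E) I (extChartAt I p).symm (range I) y (v i))) =
    η' ((extChartAt I' (f p)).symm (extChartAt I' (f p) (f x))) (fun i =>
      mfderivWithin 𝓘(ℝ, E') I' (extChartAt I' (f p)).symm (range I') (extChartAt I' (f p) (f x))
        (fderiv ℝ (extChartAt I' (f p) ∘ f ∘ (extChartAt I p).symm) y (v i)))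
  rw [h1]
  refine congrArg (η' (f x)) (funext fun i => ?_)
  rw [hd]
  exact congrArg (fun T : E' →L[ℝ] E' => T (mfderiv I I' f x
    (mfderivWithin 𝓘(ℝ, E) I (extChartAt I p).symm (range I) y (v i)))) hB.symm

theorem DiffForm.d_pullback {n : ℕ} {f : M → M'} (hf : ContMDiff I I' ∞ f) {η : DiffForm I' M' n}
    {p : M} (hη : DifferentiableAt ℝ (DiffForm.inChart I' η (f p)) (extChartAt I' (f p) (f p))) :
    DiffForm.d I (DiffForm.pullback I I' f η) p =
      (DiffForm.d I' η (f p)).compContinuousLinearMap (mfderiv I I' f p) := by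
  have hr : range I = univ := I.range_eq_univ
  have hr' : range I' = univ := I'.range_eq_univ
  have hψ : (extChartAt I' (f p) ∘ f ∘ (extChartAt I p).symm) (extChartAt I p p) =
      extChartAt I' (f p) (f p) := by simp
  unfold DiffForm.d
  rw [hr, hr', extDerivWithin_univ, extDerivWithin_univ,
    (DiffForm.inChart_pullback_eventuallyEq I I' hf η p).extDeriv_eq,
    extDeriv_pullback (r := ∞) (by rwa [hψ]) (contDiffAt_inCharts I I' hf p)
      (by simpa using WithTop.coe_le_coe.2 (le_top : (2 : ℕ∞) ≤ ⊤)), hψ]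
  have : IsManifold I 1 M := IsManifold.of_le (n := ∞) (by simp)
  have hd := (eventually_fderiv_inCharts I I' hf p).self_of_nhds.2
  refine ContinuousAlternatingMap.ext fun v => ?_
  refine congrArg (extDeriv (inChart I' η (f p)) (extChartAt I' (f p) (f p))) (funext fun i => ?_)
  have e1 : (mfderiv I 𝓘(ℝ, E) (extChartAt I p) p : E →L[ℝ] E) = ContinuousLinearMap.id ℝ E :=
    mfderiv_extChartAt_self
  have e2 : (mfderivWithin 𝓘(ℝ, E) I (extChartAt I p).symm (range I) (extChartAt I p p) :
      E →L[ℝ] E) = ContinuousLinearMap.id ℝ E := mfderivWithin_range_extChartAt_symm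
  have e3 : ∀ (x : M) (w : E), x = p →
      (mfderiv I' 𝓘(ℝ, E') (extChartAt I' (f p)) (f x) (mfderiv I I' f x w) : E') =
        mfderiv I' 𝓘(ℝ, E') (extChartAt I' (f p)) (f p) (mfderiv I I' f p w) := by
    rintro x w rfl; rfl
  refine (hd _).trans ((e3 _ _ (extChartAt_to_inv p)).trans ?_)
  have e4 : (mfderivWithin 𝓘(ℝ, E) I (extChartAt I p).symm (range I) (extChartAt I p p)
      (mfderiv I 𝓘(ℝ, E) (extChartAt I p) p (v i)) : E) = v i :=
    (congrArg (fun T : E →L[ℝ] E => T _) e2).trans (congrArg (fun T : E →L[ℝ] E => T (v i)) e1)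
  exact congrArg (fun w : E => (mfderiv I' 𝓘(ℝ, E') (extChartAt I' (f p)) (f p)
    (mfderiv I I' f p w) : E')) e4

end PullbackForm

section MaurerCartan

variable {E : Type*} [NormedAddCommGroup E] [NormedSpace ℝ E]
  {H : Type*} [TopologicalSpace H] (I : ModelWithCorners ℝ E H)
  {G : Type*} [TopologicalSpace G] [ChartedSpace H G] [Group G] [LieGroup I ∞ G]

/-- The left Maurer-Cartan form `u ↦ x⁻¹ u`. -/
def maurerCartan (x : G) : TangentSpace I x →L[ℝ] GroupLieAlgebra I G :=
  mfderiv I I (fun y : G => x⁻¹ * y) x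

theorem maurerCartan_mulInvariantVectorField (x : G) (X : GroupLieAlgebra I G) :
    maurerCartan I x (mulInvariantVectorField X x) = X := by
  have hL : ∀ a b : G, HasMFDerivAt I I (fun y : G => a * y) b (mfderiv I I (fun y : G => a * y) b) :=
    fun a b => ((contMDiff_mul_left (a := a)).mdifferentiable (n := ∞) (by simp) b).hasMFDerivAt
  have h1 : HasMFDerivAt I I (fun y : G => x⁻¹ * y) (x * 1) (maurerCartan I x) := by
    rw [mul_one]
    exact hL _ _
  have h2 := HasMFDerivAt.comp 1 h1 (hL x 1)
  have h3 : (fun y : G => x⁻¹ * y) ∘ (fun y : G => x * y) = id := by funext y; simp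
  rw [h3] at h2
  exact congrArg (fun T : E →L[ℝ] E => T X) (hasMFDerivAt_unique h2 (hasMFDerivAt_id _))

theorem mulInvariantVectorField_maurerCartan (x : G) (u : TangentSpace I x) :
    mulInvariantVectorField (maurerCartan I x u) x = u := by
  have hL : ∀ a b : G, HasMFDerivAt I I (fun y : G => a * y) b (mfderiv I I (fun y : G => a * y) b) :=
    fun a b => ((contMDiff_mul_left (a := a)).mdifferentiable (n := ∞) (by simp) b).hasMFDerivAt
  have h1 : HasMFDerivAt I I (fun y : G => x * y) (x⁻¹ * x) (mfderiv I I (fun y : G => x * y) 1) := by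
    rw [inv_mul_cancel]
    exact hL _ _
  have h2 := HasMFDerivAt.comp x h1 (hL x⁻¹ x)
  have h3 : (fun y : G => x * y) ∘ (fun y : G => x⁻¹ * y) = id := by funext y; simp
  rw [h3] at h2
  exact congrArg (fun T : E →L[ℝ] E => T u) (hasMFDerivAt_unique h2 (hasMFDerivAt_id _))

/-- The Maurer-Cartan form in the chart at `x₀`. -/
def maurerCartanInChart (x₀ : G) (e : E) : E →L[ℝ] GroupLieAlgebra I G :=
  (maurerCartan I ((extChartAt I x₀).symm e)).comp
    (mfderivWithin 𝓘(ℝ, E) I (extChartAt I x₀).symm (range I) e)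

variable [I.Boundaryless]

theorem contDiffAt_maurerCartanInChart (x₀ : G) :
    ContDiffAt ℝ ∞ (maurerCartanInChart I x₀) (extChartAt I x₀ x₀) := by
  have h := ContMDiffAt.mfderiv (I := I) (I' := I) (J := I)
    (n := ∞) (m := ∞) (x₀ := x₀) (fun p q : G => p⁻¹ * q) (fun p => p)
    (contMDiff_fst.inv.mul contMDiff_snd).contMDiffAt contMDiffAt_id (by simp)
  have hs : ContMDiffAt 𝓘(ℝ, E) I ∞ (extChartAt I x₀).symm (extChartAt I x₀ x₀) :=
    (contMDiffOn_extChartAt_symm x₀).contMDiffAt (extChartAt_target_mem_nhds x₀)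
  have h1 := (h.comp_of_eq hs (extChartAt_to_inv x₀)).contDiffAt
  refine h1.congr_of_eventuallyEq ?_
  filter_upwards [extChartAt_target_mem_nhds (I := I) x₀] with e he
  have hp : (extChartAt I x₀).symm e ∈ (chartAt H x₀).source := by
    rw [← extChartAt_source I]; exact (extChartAt I x₀).map_target he
  set p := (extChartAt I x₀).symm e with hpe
  refine Eq.trans ?_ (inTangentCoordinates_eq_mfderiv_comp (I := I)
    (I' := I) (f := fun p : G => p) (g := fun p : G => p⁻¹ * p)
    (ϕ := fun p => mfderiv I I (fun y : G => p⁻¹ * y) p) hp (by simp)).symm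
  have e3 : (mfderiv I 𝓘(ℝ, E) (extChartAt I (x₀⁻¹ * x₀)) (p⁻¹ * p) : E →L[ℝ] E) =
      ContinuousLinearMap.id ℝ E := by
    rw [inv_mul_cancel, inv_mul_cancel]
    exact mfderiv_extChartAt_self
  erw [e3]
  have e4 : extChartAt I x₀ p = e := (extChartAt I x₀).right_inv he
  rw [e4]
  rfl

omit [I.Boundaryless] in
theorem maurerCartanInChart_self (x₀ : G) (u : E) :
    maurerCartanInChart I x₀ (extChartAt I x₀ x₀) u = maurerCartan I x₀ u := by
  have e2 : (mfderivWithin 𝓘(ℝ, E) I (extChartAt I x₀).symm (range I) (extChartAt I x₀ x₀) :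
      E →L[ℝ] E) = ContinuousLinearMap.id ℝ E := mfderivWithin_range_extChartAt_symm
  have e3 : ∀ (x : G) (w : E), x = x₀ → (maurerCartan I x w : E) = maurerCartan I x₀ w := by
    rintro x w rfl; rfl
  refine (e3 _ _ (extChartAt_to_inv x₀)).trans ?_
  exact congrArg (fun T : E →L[ℝ] E => (maurerCartan I x₀ (T u) : E)) e2

variable [FiniteDimensional ℝ E]

/-- The Maurer-Cartan equation `dA(u, v) = -⁅A u, A v⁆`. -/
theorem fderiv_maurerCartanInChart (x₀ : G) (u v : E) :
    fderiv ℝ (maurerCartanInChart I x₀) (extChartAt I x₀ x₀) u v -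
      fderiv ℝ (maurerCartanInChart I x₀) (extChartAt I x₀ x₀) v u =
        -⁅maurerCartan I x₀ u, maurerCartan I x₀ v⁆ := by
  have : CompleteSpace E := FiniteDimensional.complete ℝ E
  set e := extChartAt I x₀ x₀ with he
  have hA : HasFDerivAt (maurerCartanInChart I x₀) (fderiv ℝ (maurerCartanInChart I x₀) e) e :=
    ((contDiffAt_maurerCartanInChart I x₀).differentiableAt (by simp)).hasFDerivAt
  let V : GroupLieAlgebra I G → E → E := fun X =>
    mpullbackWithin 𝓘(ℝ, E) I (extChartAt I x₀).symm (mulInvariantVectorField X) (range I)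
  have hV : ∀ X, DifferentiableAt ℝ (V X) e := by
    intro X
    have : IsManifold I 2 G :=
      IsManifold.of_le (n := ∞) (WithTop.coe_le_coe.2 (le_top : (2 : ℕ∞) ≤ ⊤))
    have h := (mdifferentiableAt_mulInvariantVectorField (I := I) X
      (g := x₀)).mdifferentiableWithinAt (s := univ)
    have h2 : DifferentiableWithinAt ℝ (V X) ((extChartAt I x₀).symm ⁻¹' univ ∩ range I) e :=
      MDifferentiableWithinAt.differentiableWithinAt_mpullbackWithin_vectorField h
    have hr : range I = univ := I.range_eq_univ
    rwa [hr, preimage_univ, univ_inter, differentiableWithinAt_univ] at h2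
  have hAV : ∀ X, ∀ᶠ a in 𝓝 e, maurerCartanInChart I x₀ a (V X a) = X := by
    intro X
    filter_upwards [extChartAt_target_mem_nhds (I := I) x₀] with a ha
    have h1 : V X a = mfderiv I 𝓘(ℝ, E) (extChartAt I x₀) ((extChartAt I x₀).symm a)
        (mulInvariantVectorField X ((extChartAt I x₀).symm a)) :=
      mpullbackWithin_extChartAt_symm_apply I _ ha
    rw [h1]
    refine Eq.trans ?_ (maurerCartan_mulInvariantVectorField I ((extChartAt I x₀).symm a) X)
    have h2 := mfderivWithin_extChartAt_symm_comp_mfderiv_extChartAt (I := I) ha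
    exact congrArg (fun T : E →L[ℝ] E => (maurerCartan I ((extChartAt I x₀).symm a)
      (T (mulInvariantVectorField X ((extChartAt I x₀).symm a))) : E)) h2
  have hVe : ∀ w : E, V (maurerCartan I x₀ w) e = w := by
    intro w
    have h1 : V (maurerCartan I x₀ w) e = mfderiv I 𝓘(ℝ, E) (extChartAt I x₀)
        ((extChartAt I x₀).symm e)
        (mulInvariantVectorField (maurerCartan I x₀ w) ((extChartAt I x₀).symm e)) :=
      mpullbackWithin_extChartAt_symm_apply I _ (mem_extChartAt_target x₀)
    have h2 : (mfderiv I 𝓘(ℝ, E) (extChartAt I x₀) x₀ : E →L[ℝ] E) = ContinuousLinearMap.id ℝ E :=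
      mfderiv_extChartAt_self
    rw [h1, he, extChartAt_to_inv]
    exact (congrArg (fun T : E →L[ℝ] E => T _) h2).trans
      (mulInvariantVectorField_maurerCartan I x₀ w)
  have hD : ∀ X w, fderiv ℝ (maurerCartanInChart I x₀) e w (V X e) +
      maurerCartanInChart I x₀ e (fderiv ℝ (V X) e w) = 0 := by
    intro X w
    have h1 := hA.clm_apply (hV X).hasFDerivAt
    have h2 := (hasFDerivAt_const (𝕜 := ℝ) X e).congr_of_eventuallyEq (hAV X)
    have h3 := congrArg (fun T : E →L[ℝ] GroupLieAlgebra I G => T w) (h1.unique h2)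
    simp only [_root_.add_apply, ContinuousLinearMap.comp_apply,
      ContinuousLinearMap.flip_apply, _root_.zero_apply] at h3
    rw [add_comm]
    exact h3
  have h1 := hD (maurerCartan I x₀ v) u
  have h2 := hD (maurerCartan I x₀ u) v
  rw [hVe] at h1 h2
  have hb : lieBracket ℝ (V (maurerCartan I x₀ u)) (V (maurerCartan I x₀ v)) e =
      mulInvariantVectorField ⁅maurerCartan I x₀ u, maurerCartan I x₀ v⁆ x₀ := by
    rw [GroupLieAlgebra.bracket_def, mulInvariantVector_mlieBracket]
    exact (mlieBracket_eq_lieBracket I _ _ x₀).symm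
  have h3 : maurerCartanInChart I x₀ e
      (lieBracket ℝ (V (maurerCartan I x₀ u)) (V (maurerCartan I x₀ v)) e) =
      ⁅maurerCartan I x₀ u, maurerCartan I x₀ v⁆ := by
    rw [hb]
    exact (maurerCartanInChart_self I x₀ _).trans (maurerCartan_mulInvariantVectorField I x₀ _)
  rw [lieBracket_eq] at h3
  simp only [hVe, map_sub] at h3
  rw [← h3, eq_neg_of_add_eq_zero_left h1, eq_neg_of_add_eq_zero_left h2]
  abel

end MaurerCartan

section OneForms

variable {P : Type*} [NormedAddCommGroup P] [NormedSpace ℝ P] {T : P → P →L[ℝ] ℝ} {y : P}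

theorem differentiableAt_ofSubsingleton (hT : DifferentiableAt ℝ T y) :
    DifferentiableAt ℝ
      (fun z => ContinuousAlternatingMap.ofSubsingleton ℝ P ℝ (0 : Fin 1) (T z)) y :=
  (ContinuousAlternatingMap.ofSubsingletonLIE (𝕜 := ℝ) (E := P) (F := ℝ)
    (0 : Fin 1)).toContinuousLinearEquiv.differentiableAt.comp y hT

theorem extDeriv_ofSubsingleton_apply (hT : DifferentiableAt ℝ T y) (v w : P) :
    extDeriv (fun z => ContinuousAlternatingMap.ofSubsingleton ℝ P ℝ (0 : Fin 1) (T z)) y ![v, w] =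
      fderiv ℝ (fun z => T z w) y v - fderiv ℝ (fun z => T z v) y w := by
  rw [extDeriv_apply (differentiableAt_ofSubsingleton hT)]
  simp [Fin.sum_univ_two, Fin.removeNth, sub_eq_add_neg]

end OneForms

section TautologicalForm

variable {E F : Type*} [NormedAddCommGroup E] [NormedSpace ℝ E] [NormedAddCommGroup F]
  [NormedSpace ℝ F]

/-- The one-form `⟨μ, A u⟩ + ⟨ξ, Z - B Y (A u)⟩` at `(e, Y, μ, ξ)`. -/
def tautForm (A : E → E →L[ℝ] F) (B : F →L[ℝ] F →L[ℝ] F)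
    (y : E × F × (F →L[ℝ] ℝ) × (F →L[ℝ] ℝ)) : E × F × (F →L[ℝ] ℝ) × (F →L[ℝ] ℝ) →L[ℝ] ℝ :=
  (y.2.2.1.comp (A y.1)).comp (ContinuousLinearMap.fst ℝ _ _) +
    y.2.2.2.comp ((ContinuousLinearMap.fst ℝ _ _).comp (ContinuousLinearMap.snd ℝ _ _) -
      ((B y.2.1).comp (A y.1)).comp (ContinuousLinearMap.fst ℝ _ _))

theorem differentiableAt_tautForm {A : E → E →L[ℝ] F} (B : F →L[ℝ] F →L[ℝ] F)
    {y : E × F × (F →L[ℝ] ℝ) × (F →L[ℝ] ℝ)} (hA : DifferentiableAt ℝ A y.1) :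
    DifferentiableAt ℝ (tautForm A B) y := by
  have h1 : DifferentiableAt ℝ (fun z : E × F × (F →L[ℝ] ℝ) × (F →L[ℝ] ℝ) => A z.1) y :=
    DifferentiableAt.comp y hA differentiableAt_fst
  have h2 : DifferentiableAt ℝ (fun z : E × F × (F →L[ℝ] ℝ) × (F →L[ℝ] ℝ) => B z.2.1) y :=
    B.differentiableAt.comp y (by fun_prop)
  have hμ : DifferentiableAt ℝ (fun z : E × F × (F →L[ℝ] ℝ) × (F →L[ℝ] ℝ) => z.2.2.1) y := by
    fun_prop
  have hξ : DifferentiableAt ℝ (fun z : E × F × (F →L[ℝ] ℝ) × (F →L[ℝ] ℝ) => z.2.2.2) y := by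
    fun_prop
  exact ((hμ.clm_comp h1).clm_comp (differentiableAt_const _)).add
    (hξ.clm_comp ((differentiableAt_const _).sub
      ((h2.clm_comp h1).clm_comp (differentiableAt_const _))))

theorem fderiv_tautForm_apply {A : E → E →L[ℝ] F} (B : F →L[ℝ] F →L[ℝ] F)
    {y : E × F × (F →L[ℝ] ℝ) × (F →L[ℝ] ℝ)} (hA : DifferentiableAt ℝ A y.1)
    (v w : E × F × (F →L[ℝ] ℝ) × (F →L[ℝ] ℝ)) :
    fderiv ℝ (fun z => tautForm A B z w) y v =
      v.2.2.1 (A y.1 w.1) + y.2.2.1 (fderiv ℝ A y.1 v.1 w.1) +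
      v.2.2.2 (w.2.1 - B y.2.1 (A y.1 w.1)) -
      y.2.2.2 (B v.2.1 (A y.1 w.1) + B y.2.1 (fderiv ℝ A y.1 v.1 w.1)) := by
  have hy := hasFDerivAt_id (𝕜 := ℝ) y
  have h1 : HasFDerivAt (fun z : E × F × (F →L[ℝ] ℝ) × (F →L[ℝ] ℝ) => A z.1) _ y :=
    HasFDerivAt.comp y hA.hasFDerivAt hasFDerivAt_fst
  have h1' := h1.clm_apply (hasFDerivAt_const w.1 y)
  have h2 : HasFDerivAt (fun z : E × F × (F →L[ℝ] ℝ) × (F →L[ℝ] ℝ) => B z.2.1) _ y :=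
    B.hasFDerivAt.comp y hy.snd.fst
  have h3 := h2.clm_apply h1'
  have h4 := (hy.snd.snd.fst.clm_apply h1').add
    (hy.snd.snd.snd.clm_apply (h3.const_sub w.2.1))
  have h5 : HasFDerivAt (fun z => tautForm A B z w) _ y := h4
  rw [h5.fderiv]
  simp
  abel

end TautologicalForm

section TrivializedForm

variable {E : Type*} [NormedAddCommGroup E] [NormedSpace ℝ E] [FiniteDimensional ℝ E]
  {H : Type*} [TopologicalSpace H] (I : ModelWithCorners ℝ E H)
  {G : Type*} [TopologicalSpace G] [ChartedSpace H G] [Group G] [LieGroup I ∞ G]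

variable (G) in
/-- The bracket of the Lie algebra as a continuous bilinear map. -/
def bracketCLM : GroupLieAlgebra I G →L[ℝ] GroupLieAlgebra I G →L[ℝ] GroupLieAlgebra I G :=
  LinearMap.toContinuousLinearMap
    ((LinearMap.toContinuousLinearMap (𝕜 := ℝ) (E := GroupLieAlgebra I G)
        (F' := GroupLieAlgebra I G)).toLinearMap.comp
      (LinearMap.mk₂ ℝ (fun Y Z : GroupLieAlgebra I G => ⁅Y, Z⁆) add_lie smul_lie lie_add
        (fun c Y Z => lie_smul c Y Z)))

theorem bracketCLM_apply (Y Z : GroupLieAlgebra I G) : bracketCLM I G Y Z = ⁅Y, Z⁆ := rfl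

/-- The tautological one-form transported by the left trivialization, at a point. -/
def trivCovector (z : Phase I G) : TangentSpace (phaseModel I G) z →L[ℝ] ℝ :=
  tautForm (E := E) (fun _ => maurerCartan I z.1) (bracketCLM I G) (0, z.2)

variable (G) in
/-- The tautological one-form transported by the left trivialization. -/
def trivForm : DiffForm (phaseModel I G) (Phase I G) 1 :=
  fun z => ContinuousAlternatingMap.ofSubsingleton ℝ (TangentSpace (phaseModel I G) z) ℝ (0 : Fin 1)
    (trivCovector I z)

variable [I.Boundaryless]

omit [FiniteDimensional ℝ E] in
theorem mfderivWithin_phase_extChartAt_symm (z : Phase I G)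
    {y : E × GroupLieAlgebra I G × LieDual I G × LieDual I G}
    (hy : y.1 ∈ (extChartAt I z.1).target)
    (w : E × GroupLieAlgebra I G × LieDual I G × LieDual I G) :
    mfderivWithin 𝓘(ℝ, E × GroupLieAlgebra I G × LieDual I G × LieDual I G) (phaseModel I G)
      (extChartAt (phaseModel I G) z).symm (range (phaseModel I G)) y w =
      ((mfderivWithin 𝓘(ℝ, E) I (extChartAt I z.1).symm (range I) y.1 w.1 : E), w.2) := by
  have hr : range (phaseModel I G) = univ := (phaseModel I G).range_eq_univ
  have h1 : HasMFDerivAt 𝓘(ℝ, E × GroupLieAlgebra I G × LieDual I G × LieDual I G) I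
      (fun y : E × GroupLieAlgebra I G × LieDual I G × LieDual I G => (extChartAt I z.1).symm y.1) y
      ((mfderivWithin 𝓘(ℝ, E) I (extChartAt I z.1).symm (range I) y.1).comp
        (ContinuousLinearMap.fst ℝ E (GroupLieAlgebra I G × LieDual I G × LieDual I G))) :=
    HasMFDerivAt.comp y (hasMFDerivAt_extChartAt_symm I hy) hasFDerivAt_fst.hasMFDerivAt
  have h := hasFDerivAt_id (𝕜 := ℝ) y
  have h2 := h1.prodMk (h.snd.fst.hasMFDerivAt.prodMk
    (h.snd.snd.fst.hasMFDerivAt.prodMk h.snd.snd.snd.hasMFDerivAt))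
  have h3 : (extChartAt (phaseModel I G) z).symm =
      fun y : E × GroupLieAlgebra I G × LieDual I G × LieDual I G =>
        ((extChartAt I z.1).symm y.1, y.2.1, y.2.2.1, y.2.2.2) := by
    rfl
  rw [hr, mfderivWithin_univ, h3]
  exact congrArg (fun T : (E × GroupLieAlgebra I G × LieDual I G × LieDual I G) →L[ℝ]
    (E × GroupLieAlgebra I G × LieDual I G × LieDual I G) => T w) h2.mfderiv

theorem inChart_trivForm (z : Phase I G) :
    DiffForm.inChart (phaseModel I G) (trivForm I G) z =ᶠ[𝓝 (extChartAt (phaseModel I G) z z)]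
      fun y => ContinuousAlternatingMap.ofSubsingleton ℝ _ ℝ (0 : Fin 1)
        (tautForm (maurerCartanInChart I z.1) (bracketCLM I G) y) := by
  filter_upwards [extChartAt_target_mem_nhds (I := phaseModel I G) z] with y hy
  have hy' : y.1 ∈ (extChartAt I z.1).target := by
    rw [extChartAt_prod] at hy
    exact hy.1
  refine ContinuousAlternatingMap.ext fun v => ?_
  have h := mfderivWithin_phase_extChartAt_symm I z hy' (v 0)
  have h3 : (extChartAt (phaseModel I G) z).symm y =
      ((extChartAt I z.1).symm y.1, y.2) := rfl
  let T : Phase I G → E × GroupLieAlgebra I G × LieDual I G × LieDual I G →L[ℝ] ℝ :=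
    fun z => trivCovector I z
  change T ((extChartAt (phaseModel I G) z).symm y) (mfderivWithin
    𝓘(ℝ, E × GroupLieAlgebra I G × LieDual I G × LieDual I G) (phaseModel I G)
      (extChartAt (phaseModel I G) z).symm (range (phaseModel I G)) y (v 0)) =
      tautForm (maurerCartanInChart I z.1) (bracketCLM I G) y (v 0)
  refine (congrArg (T _) h).trans ?_
  rw [h3]
  rfl

theorem differentiableAt_inChart_trivForm (z : Phase I G) :
    DifferentiableAt ℝ (DiffForm.inChart (phaseModel I G) (trivForm I G) z)
      (extChartAt (phaseModel I G) z z) := by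
  refine DifferentiableAt.congr_of_eventuallyEq ?_ (inChart_trivForm I z)
  refine differentiableAt_ofSubsingleton (differentiableAt_tautForm _ ?_)
  exact (contDiffAt_maurerCartanInChart I z.1).differentiableAt (by simp)

/-- The exterior derivative of the transported tautological form. -/
theorem d_trivForm_apply (z : Phase I G)
    (v w : TangentSpace I z.1 × GroupLieAlgebra I G × LieDual I G × LieDual I G) :
    DiffForm.d (phaseModel I G) (trivForm I G) z ![phaseTangent I z v, phaseTangent I z w] =
      (v.2.2.1 (maurerCartan I z.1 w.1) - w.2.2.1 (maurerCartan I z.1 v.1)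
        - z.2.2.1 ⁅maurerCartan I z.1 v.1, maurerCartan I z.1 w.1⁆)
      + (v.2.2.2 (w.2.1 - ⁅z.2.1, maurerCartan I z.1 w.1⁆)
        - w.2.2.2 (v.2.1 - ⁅z.2.1, maurerCartan I z.1 v.1⁆))
      - z.2.2.2 (⁅v.2.1, maurerCartan I z.1 w.1⁆ - ⁅w.2.1, maurerCartan I z.1 v.1⁆
        - ⁅z.2.1, ⁅maurerCartan I z.1 v.1, maurerCartan I z.1 w.1⁆⁆) := by
  have hr : range (phaseModel I G) = univ := (phaseModel I G).range_eq_univ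
  have he : extChartAt (phaseModel I G) z z = (extChartAt I z.1 z.1, z.2) := rfl
  have hA : DifferentiableAt ℝ (maurerCartanInChart I z.1) (extChartAt I z.1 z.1) :=
    (contDiffAt_maurerCartanInChart I z.1).differentiableAt (by simp)
  have hid : (mfderiv (phaseModel I G)
      𝓘(ℝ, E × GroupLieAlgebra I G × LieDual I G × LieDual I G) (extChartAt (phaseModel I G) z) z :
      (E × GroupLieAlgebra I G × LieDual I G × LieDual I G) →L[ℝ]
        (E × GroupLieAlgebra I G × LieDual I G × LieDual I G)) = ContinuousLinearMap.id ℝ _ :=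
    mfderiv_extChartAt_self
  let v' : E × GroupLieAlgebra I G × LieDual I G × LieDual I G := v
  let w' : E × GroupLieAlgebra I G × LieDual I G × LieDual I G := w
  have h1 : DiffForm.d (phaseModel I G) (trivForm I G) z ![phaseTangent I z v, phaseTangent I z w] =
      extDeriv (DiffForm.inChart (phaseModel I G) (trivForm I G) z)
        (extChartAt (phaseModel I G) z z) ![v', w'] := by
    unfold DiffForm.d
    rw [hr, extDerivWithin_univ]
    refine congrArg (extDeriv _ _) (funext fun i => ?_)
    refine (congrArg (fun T : (E × GroupLieAlgebra I G × LieDual I G × LieDual I G) →L[ℝ]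
        (E × GroupLieAlgebra I G × LieDual I G × LieDual I G) => T _) hid).trans ?_
    fin_cases i <;> rfl
  rw [h1, (inChart_trivForm I z).extDeriv_eq, he, extDeriv_ofSubsingleton_apply (differentiableAt_tautForm _ hA),
    fderiv_tautForm_apply _ hA, fderiv_tautForm_apply _ hA]
  have hmc := fderiv_maurerCartanInChart I z.1 v'.1 w'.1
  have hv := maurerCartanInChart_self I z.1 v'.1
  have hw := maurerCartanInChart_self I z.1 w'.1
  simp only [hv, hw, bracketCLM_apply]
  change _ = (v'.2.2.1 (maurerCartan I z.1 w'.1) - w'.2.2.1 (maurerCartan I z.1 v'.1)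
        - z.2.2.1 ⁅maurerCartan I z.1 v'.1, maurerCartan I z.1 w'.1⁆)
      + (v'.2.2.2 (w'.2.1 - ⁅z.2.1, maurerCartan I z.1 w'.1⁆)
        - w'.2.2.2 (v'.2.1 - ⁅z.2.1, maurerCartan I z.1 v'.1⁆))
      - z.2.2.2 (⁅v'.2.1, maurerCartan I z.1 w'.1⁆ - ⁅w'.2.1, maurerCartan I z.1 v'.1⁆
        - ⁅z.2.1, ⁅maurerCartan I z.1 v'.1, maurerCartan I z.1 w'.1⁆⁆)
  generalize fderiv ℝ (maurerCartanInChart I z.1) (extChartAt I z.1 z.1) v'.1 w'.1 = D₁ at hmc ⊢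
  generalize fderiv ℝ (maurerCartanInChart I z.1) (extChartAt I z.1 z.1) w'.1 v'.1 = D₂ at hmc ⊢
  obtain rfl := sub_eq_iff_eq_add.1 hmc
  simp only [map_add, map_sub, map_neg, lie_add, lie_neg]
  ring

end TrivializedForm

section PhaseForm

variable {E : Type*} [NormedAddCommGroup E] [NormedSpace ℝ E] [FiniteDimensional ℝ E]
  {H : Type*} [TopologicalSpace H] (I : ModelWithCorners ℝ E H) [I.Boundaryless]
  {G : Type*} [TopologicalSpace G] [ChartedSpace H G] [Group G] [LieGroup I ∞ G]

theorem leftTrivInv_apply (z : Phase I G) (u : TangentSpace I z.1) (Z : GroupLieAlgebra I G) :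
    (leftTrivInv I z).2 (semiTangent I (z.1, z.2.1) (u, Z)) =
      z.2.2.1 (maurerCartan I z.1 u) + z.2.2.2 (Z - ⁅z.2.1, maurerCartan I z.1 u⁆) := by
  have h := semiLeftInv_apply I (z.1, z.2.1) (maurerCartan I z.1 u) Z
  rw [mulInvariantVectorField_maurerCartan] at h
  change (z.2.2.1.coprod z.2.2.2) ((semiTangent I (1 : G × GroupLieAlgebra I G)).symm
    (semiLeftInv I (z.1, z.2.1) (semiTangent I (z.1, z.2.1) (u, Z)))) = _
  rw [h, ContinuousLinearEquiv.symm_apply_apply]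
  rfl

omit [FiniteDimensional ℝ E] [I.Boundaryless] in
theorem mfderiv_proj_eq_leftTriv (α : CotSemi I G)
    (v : (E × GroupLieAlgebra I G) × ((E × GroupLieAlgebra I G) →L[ℝ] ℝ)) :
    let w : E × GroupLieAlgebra I G × LieDual I G × LieDual I G :=
      mfderiv (cotangentModel (semiModel I G)) (phaseModel I G) (leftTriv I) α v
    mfderiv (cotangentModel (semiModel I G)) (semiModel I G) (fun β : CotSemi I G => β.1) α v =
      semiTangent I α.1 (w.1, w.2.1) := by
  intro w
  have h1 : HasMFDerivAt (cotangentModel (semiModel I G)) (phaseModel I G) (leftTriv I) α _ :=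
    ((contMDiff_leftTriv I).mdifferentiable (by simp) α).hasMFDerivAt
  have h2 : HasMFDerivAt (phaseModel I G) I (fun z : Phase I G => z.1) (leftTriv I α) _ :=
    hasMFDerivAt_fst _
  have h3 : HasMFDerivAt (phaseModel I G)
      (𝓘(ℝ, GroupLieAlgebra I G).prod (𝓘(ℝ, LieDual I G).prod 𝓘(ℝ, LieDual I G)))
      (fun z : Phase I G => z.2) (leftTriv I α) _ := hasMFDerivAt_snd _
  have h4 : HasMFDerivAt (𝓘(ℝ, GroupLieAlgebra I G).prod (𝓘(ℝ, LieDual I G).prod 𝓘(ℝ, LieDual I G)))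
      𝓘(ℝ, GroupLieAlgebra I G)
      (fun z : GroupLieAlgebra I G × LieDual I G × LieDual I G => z.1) (leftTriv I α).2 _ :=
    hasMFDerivAt_fst _
  have h5 := (h2.prodMk (h4.comp (leftTriv I α) h3)).comp α h1
  exact congrArg (fun T : ((E × GroupLieAlgebra I G) × ((E × GroupLieAlgebra I G) →L[ℝ] ℝ)) →L[ℝ]
    (E × GroupLieAlgebra I G) => T v) h5.mfderiv

theorem pullback_leftTriv_trivForm :
    DiffForm.pullback (cotangentModel (semiModel I G)) (phaseModel I G) (leftTriv I)
      (trivForm I G) = liouvilleForm (semiModel I G) (G × GroupLieAlgebra I G) := by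
  funext α
  refine ContinuousAlternatingMap.ext fun v => ?_
  let w : E × GroupLieAlgebra I G × LieDual I G × LieDual I G :=
    mfderiv (cotangentModel (semiModel I G)) (phaseModel I G) (leftTriv I) α (v 0)
  have h := leftTrivInv_apply I (leftTriv I α) w.1 w.2.1
  rw [leftTrivInv_leftTriv] at h
  change trivCovector I (leftTriv I α) w = α.2 (mfderiv (cotangentModel (semiModel I G))
    (semiModel I G) (fun β : CotSemi I G => β.1) α (v 0))
  refine Eq.trans ?_ (congrArg α.2 (mfderiv_proj_eq_leftTriv I α (v 0))).symm
  exact h.symm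

omit [FiniteDimensional ℝ E] [I.Boundaryless] in
theorem mfderiv_leftTriv_leftTrivInv (z : Phase I G)
    (v : E × GroupLieAlgebra I G × LieDual I G × LieDual I G) :
    mfderiv (cotangentModel (semiModel I G)) (phaseModel I G) (leftTriv I) (leftTrivInv I z)
      (mfderiv (phaseModel I G) (cotangentModel (semiModel I G)) (leftTrivInv I) z v) = v := by
  have h1 : HasMFDerivAt (cotangentModel (semiModel I G)) (phaseModel I G) (leftTriv I)
      (leftTrivInv I z) _ :=
    ((contMDiff_leftTriv I).mdifferentiable (by simp) (leftTrivInv I z)).hasMFDerivAt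
  have h2 : HasMFDerivAt (phaseModel I G) (cotangentModel (semiModel I G)) (leftTrivInv I) z _ :=
    ((contMDiff_leftTrivInv I).mdifferentiable (by simp) z).hasMFDerivAt
  have h3 := HasMFDerivAt.comp z h1 h2
  have h4 : (leftTriv I ∘ leftTrivInv I : Phase I G → Phase I G) = id :=
    funext (leftTriv_leftTrivInv I)
  rw [h4] at h3
  exact congrArg (fun T : (E × GroupLieAlgebra I G × LieDual I G × LieDual I G) →L[ℝ]
    (E × GroupLieAlgebra I G × LieDual I G × LieDual I G) => T v)
    (hasMFDerivAt_unique h3 (hasMFDerivAt_id _))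

theorem phaseForm_eq_neg_d_trivForm :
    (phaseForm I : DiffForm (phaseModel I G) (Phase I G) 2) =
      fun z => -DiffForm.d (phaseModel I G) (trivForm I G) z := by
  funext z
  refine ContinuousAlternatingMap.ext fun v => ?_
  have h := DiffForm.d_pullback (cotangentModel (semiModel I G)) (phaseModel I G)
    (contMDiff_leftTriv I) (p := leftTrivInv I z)
    (differentiableAt_inChart_trivForm I (leftTriv I (leftTrivInv I z)))
  rw [pullback_leftTriv_trivForm] at h
  let D : Phase I G →
      (E × GroupLieAlgebra I G × LieDual I G × LieDual I G) [⋀^Fin 2]→L[ℝ] ℝ :=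
    fun y => DiffForm.d (phaseModel I G) (trivForm I G) y
  change -(DiffForm.d (cotangentModel (semiModel I G)) (liouvilleForm (semiModel I G)
    (G × GroupLieAlgebra I G)) (leftTrivInv I z)) (fun i => mfderiv (phaseModel I G)
      (cotangentModel (semiModel I G)) (leftTrivInv I) z (v i)) = -(D z v)
  rw [h]
  refine congrArg Neg.neg ?_
  refine (congrArg (D (leftTriv I (leftTrivInv I z)))
    (funext fun i => mfderiv_leftTriv_leftTrivInv I z (v i))).trans ?_
  rw [leftTriv_leftTrivInv]

end PhaseForm

section Hamiltonian

variable {E : Type*} [NormedAddCommGroup E] [NormedSpace ℝ E] [FiniteDimensional ℝ E]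
  {H : Type*} [TopologicalSpace H] (I : ModelWithCorners ℝ E H) [I.Boundaryless]
  {G : Type*} [TopologicalSpace G] [ChartedSpace H G] [Group G] [LieGroup I ∞ G]
  {m : Metric I G}

omit [I.Boundaryless] in
theorem apply_sharp_comm (ξ η : LieDual I G) : ξ (sharp I m η) = η (sharp I m ξ) := by
  rw [← inner_sharp I m ξ, m.symm, inner_sharp]

omit [FiniteDimensional ℝ E] [I.Boundaryless] in
theorem inner_Ad (hm : IsBiInvariant I m) (g : G) (Z W : GroupLieAlgebra I G) :
    m.inner (1 : G) (Ad I g Z) (Ad I g W) = m.inner (1 : G) Z W := by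
  have hL := fun a b : G =>
    ((contMDiff_mul_left (I := I) (a := a)).mdifferentiable (n := ∞) (by simp) b).hasMFDerivAt
  have hR := fun a b : G =>
    ((contMDiff_mul_right (I := I) (a := a)).mdifferentiable (n := ∞) (by simp) b).hasMFDerivAt
  have h1 := HasMFDerivAt.comp (1 : G) (hR g⁻¹ (g * 1)) (hL g 1)
  have h2 : Ad I g = _ := h1.mfderiv
  have h3 := (hm g⁻¹ (g * 1) (mfderiv I I (fun y : G => g * y) 1 Z)
    (mfderiv I I (fun y : G => g * y) 1 W)).2
  rw [(hm g 1 Z W).1] at h3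
  rw [← h3, h2]
  have h4 : g * 1 * g⁻¹ = 1 := by simp
  let B : G → E →L[ℝ] E →L[ℝ] ℝ := fun x => m.inner x
  change B 1 _ _ = B (g * 1 * g⁻¹) _ _
  rw [h4]
  rfl

theorem inner_lie_self (hm : IsBiInvariant I m) (X Z : GroupLieAlgebra I G) :
    m.inner (1 : G) Z ⁅Z, X⁆ = 0 := by
  let V := GroupLieAlgebra I G
  let B : V →L[ℝ] V →L[ℝ] ℝ := m.inner (1 : G)
  have hs : ContMDiff I 𝓘(ℝ, V) ∞ (fun g : G => Ad I g⁻¹ Z) :=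
    contMDiff_Ad_apply I (contMDiff_inv I ∞) contMDiff_const
  have h1 : HasMFDerivAt I 𝓘(ℝ, V) (fun g : G => Ad I g⁻¹ Z) 1 _ :=
    (hs.mdifferentiable (by simp) 1).hasMFDerivAt
  have hB : HasFDerivAt (fun W : V => B W W) _ (Ad I (1 : G)⁻¹ Z) :=
    B.hasFDerivAt.clm_apply (hasFDerivAt_id _)
  have h2 := HasMFDerivAt.comp (1 : G) hB.hasMFDerivAt h1
  have h3 : ((fun W : V => B W W) ∘ fun g : G => Ad I g⁻¹ Z) = fun _ => B Z Z :=
    funext fun g => inner_Ad I hm g⁻¹ Z Z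
  rw [h3] at h2
  have h4 := congrArg (fun T : E →L[ℝ] ℝ => T X)
    (hasMFDerivAt_unique h2 (hasMFDerivAt_const (I := I) (B Z Z) (1 : G)))
  have h5 := mfderiv_Ad_inv_apply I X Z
  let W : V := mfderiv I 𝓘(ℝ, V) (fun g : G => Ad I g⁻¹ Z) 1 X
  have h6 : B (Ad I (1 : G)⁻¹ Z) W + B W (Ad I (1 : G)⁻¹ Z) = 0 := h4
  have h7 : W = ⁅Z, X⁆ := h5
  rw [h7, inv_one, Ad_one] at h6
  have h8 : B ⁅Z, X⁆ Z = B Z ⁅Z, X⁆ := m.symm 1 _ _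
  have h9 : B Z ⁅Z, X⁆ + B ⁅Z, X⁆ Z = 0 := h6
  change B Z ⁅Z, X⁆ = 0
  linarith

theorem apply_lie_sharp (hm : IsBiInvariant I m) (ξ : LieDual I G) (X : GroupLieAlgebra I G) :
    ξ ⁅sharp I m ξ, X⁆ = 0 := by
  rw [← inner_sharp I m ξ, inner_lie_self I hm]

variable (m) in
/-- The musical isomorphism as a continuous linear map. -/
def sharpCLM : LieDual I G →L[ℝ] GroupLieAlgebra I G :=
  ContinuousLinearMap.inverse
    (show GroupLieAlgebra I G →L[ℝ] LieDual I G from m.inner (1 : G))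

omit [I.Boundaryless] in
theorem mfderiv_ham_apply (z : Phase I G)
    (w : TangentSpace I z.1 × GroupLieAlgebra I G × LieDual I G × LieDual I G) :
    mfderiv (phaseModel I G) 𝓘(ℝ, ℝ) (ham I m) z (phaseTangent I z w) =
      w.2.2.1 z.2.1 + z.2.2.1 w.2.1 + w.2.2.2 (sharp I m z.2.2.2) := by
  let V := GroupLieAlgebra I G
  let W := V × LieDual I G × LieDual I G
  have h0 : HasMFDerivAt (phaseModel I G)
      (𝓘(ℝ, V).prod (𝓘(ℝ, LieDual I G).prod 𝓘(ℝ, LieDual I G)))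
      (fun z : Phase I G => z.2) z _ := hasMFDerivAt_snd _
  have hy := hasFDerivAt_id (𝕜 := ℝ) (z.2 : W)
  have h1 := (hy.snd.fst.clm_apply hy.fst).add ((hy.snd.snd.clm_apply
    ((sharpCLM I m).hasFDerivAt.comp z.2 hy.snd.snd)).const_mul (1 / 2))
  have h2 : HasMFDerivAt (𝓘(ℝ, V).prod (𝓘(ℝ, LieDual I G).prod 𝓘(ℝ, LieDual I G))) 𝓘(ℝ, ℝ)
      (fun y : V × LieDual I G × LieDual I G =>
        y.2.1 y.1 + 1 / 2 * y.2.2 (sharpCLM I m y.2.2)) z.2 _ :=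
    ⟨h1.continuousAt, h1.hasFDerivWithinAt⟩
  have h3 := HasMFDerivAt.comp z h2 h0
  have h4 := congrArg (fun T : (E × V × LieDual I G × LieDual I G) →L[ℝ] ℝ => T w) h3.mfderiv
  refine h4.trans ?_
  change z.2.2.1 w.2.1 + w.2.2.1 z.2.1 + 1 / 2 * (z.2.2.2 (sharp I m w.2.2.2) +
    w.2.2.2 (sharp I m z.2.2.2)) = _
  rw [apply_sharp_comm I z.2.2.2]
  ring

end Hamiltonian

section HamiltonianVectorField

variable {E : Type*} [NormedAddCommGroup E] [NormedSpace ℝ E] [FiniteDimensional ℝ E]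
  {H : Type*} [TopologicalSpace H] (I : ModelWithCorners ℝ E H)
  {G : Type*} [TopologicalSpace G] [ChartedSpace H G] [Group G] [LieGroup I ∞ G]
  (m : Metric I G)

/-- The Hamiltonian vector field of `ham`. -/
def hamVectorField (z : Phase I G) : TangentSpace (phaseModel I G) z :=
  phaseTangent I z (mulInvariantVectorField z.2.1 z.1, sharp I m z.2.2.2, 0,
    -z.2.2.1 + coad I z.2.1 z.2.2.2)

section Form

variable [I.Boundaryless]

theorem phaseForm_apply (z : Phase I G)
    (v w : TangentSpace I z.1 × GroupLieAlgebra I G × LieDual I G × LieDual I G) :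
    phaseForm I z ![phaseTangent I z v, phaseTangent I z w] =
      (w.2.2.1 (maurerCartan I z.1 v.1) - v.2.2.1 (maurerCartan I z.1 w.1)
        + z.2.2.1 ⁅maurerCartan I z.1 v.1, maurerCartan I z.1 w.1⁆)
      + (w.2.2.2 (v.2.1 - ⁅z.2.1, maurerCartan I z.1 v.1⁆)
        - v.2.2.2 (w.2.1 - ⁅z.2.1, maurerCartan I z.1 w.1⁆))
      + z.2.2.2 (⁅v.2.1, maurerCartan I z.1 w.1⁆ - ⁅w.2.1, maurerCartan I z.1 v.1⁆
        - ⁅z.2.1, ⁅maurerCartan I z.1 v.1, maurerCartan I z.1 w.1⁆⁆) := by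
  rw [phaseForm_eq_neg_d_trivForm]
  refine (congrArg Neg.neg (d_trivForm_apply I z v w)).trans ?_
  ring

theorem eq_zero_of_phaseForm_eq_zero (z : Phase I G)
    (v : TangentSpace I z.1 × GroupLieAlgebra I G × LieDual I G × LieDual I G)
    (h : ∀ w, phaseForm I z ![phaseTangent I z v, phaseTangent I z w] = 0) : v = 0 := by
  simp only [phaseForm_apply] at h
  obtain ⟨u, Y, μ, ξ⟩ := v
  have hu : maurerCartan I z.1 u = 0 := by
    by_contra hne
    obtain ⟨f, hf⟩ := SeparatingDual.exists_ne_zero (R := ℝ) hne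
    exact hf (by simpa using h (0, 0, f, 0))
  have hu' : u = 0 := by
    rw [← mulInvariantVectorField_maurerCartan I z.1 u, hu]
    exact map_zero _
  simp only [hu] at h
  have hY : Y = 0 := by
    by_contra hne
    obtain ⟨f, hf⟩ := SeparatingDual.exists_ne_zero (R := ℝ) hne
    exact hf (by simpa using h (0, 0, 0, f))
  have hξ : ξ = 0 := by
    ext Z
    simpa using h (0, Z, 0, 0)
  have hμ : μ = 0 := by
    ext X
    simpa [hY, hξ, maurerCartan_mulInvariantVectorField] using
      h (mulInvariantVectorField X z.1, 0, 0, 0)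
  rw [hu', hY, hμ, hξ]
  rfl

variable {m}

theorem isHamiltonianVectorField_hamVectorField (hm : IsBiInvariant I m) :
    IsHamiltonianVectorField (phaseModel I G) (phaseForm I) (ham I m) (hamVectorField I m) := by
  intro z w
  have h := phaseForm_apply I z (mulInvariantVectorField z.2.1 z.1, sharp I m z.2.2.2, 0,
    -z.2.2.1 + coad I z.2.1 z.2.2.2) ((phaseTangent I z).symm w)
  have h' := mfderiv_ham_apply I (m := m) z ((phaseTangent I z).symm w)
  rw [ContinuousLinearEquiv.apply_symm_apply] at h h'
  refine h.trans (Eq.trans ?_ h'.symm)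
  generalize (phaseTangent I z).symm w = w
  obtain ⟨u, Z, ν, η⟩ := w
  simp only [maurerCartan_mulInvariantVectorField, lie_self, sub_zero, map_sub,
    apply_lie_sharp I hm, _root_.add_apply, _root_.neg_apply, _root_.zero_apply, coad_apply]
  rw [← lie_skew Z z.2.1, map_neg]
  ring

theorem IsHamiltonianVectorField.eq_hamVectorField (hm : IsBiInvariant I m)
    {X : (z : Phase I G) → TangentSpace (phaseModel I G) z}
    (hX : IsHamiltonianVectorField (phaseModel I G) (phaseForm I) (ham I m) X) :
    X = hamVectorField I m := by
  funext z
  rw [← sub_eq_zero]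
  have h := eq_zero_of_phaseForm_eq_zero I z ((phaseTangent I z).symm (X z - hamVectorField I m z))
  rw [ContinuousLinearEquiv.map_eq_zero_iff] at h
  refine h fun w => ?_
  rw [ContinuousLinearEquiv.apply_symm_apply]
  have h1 := hX z (phaseTangent I z w)
  rw [← isHamiltonianVectorField_hamVectorField I hm z (phaseTangent I z w)] at h1
  have h2 := (phaseForm I z).map_update_sub ![0, phaseTangent I z w] 0 (X z)
    (hamVectorField I m z)
  have he : ∀ a : TangentSpace (phaseModel I G) z,
      Function.update ![0, phaseTangent I z w] 0 a = ![a, phaseTangent I z w] := fun a => by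
    funext i
    fin_cases i <;> rfl
  simp only [he] at h2
  exact h2.trans (sub_eq_zero.2 h1)

end Form

theorem isMIntegralCurveOn_hamVectorField_iff (x : ℝ → G) (Y : ℝ → GroupLieAlgebra I G)
    (μ ξ : ℝ → LieDual I G) (s : Set ℝ) :
    IsMIntegralCurveOn (fun t => ((x t, Y t, μ t, ξ t) : Phase I G)) (hamVectorField I m) s ↔
      ∀ t ∈ s,
        HasMFDerivWithinAt 𝓘(ℝ, ℝ) I x s t
          ((1 : ℝ →L[ℝ] ℝ).smulRight (mulInvariantVectorField (Y t) (x t))) ∧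
        HasDerivWithinAt Y (sharp I m (ξ t)) s t ∧
        HasDerivWithinAt μ 0 s t ∧
        HasDerivWithinAt ξ (-μ t + coad I (Y t) (ξ t)) s t := by
  refine forall₂_congr fun t _ => ⟨fun h => ?_, fun ⟨h1, h2, h3, h4⟩ => ?_⟩
  · have hx := HasMFDerivAt.comp_hasMFDerivWithinAt t
      (hasMFDerivAt_fst (I := I)
        (I' := 𝓘(ℝ, GroupLieAlgebra I G).prod (𝓘(ℝ, LieDual I G).prod 𝓘(ℝ, LieDual I G)))
        ((x t, Y t, μ t, ξ t) : Phase I G)) h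
    have hr := HasMFDerivAt.comp_hasMFDerivWithinAt t
      (hasMFDerivAt_snd (I := I)
        (I' := 𝓘(ℝ, GroupLieAlgebra I G).prod (𝓘(ℝ, LieDual I G).prod 𝓘(ℝ, LieDual I G)))
        ((x t, Y t, μ t, ξ t) : Phase I G)) h
    have hY := HasMFDerivAt.comp_hasMFDerivWithinAt t
      (hasMFDerivAt_fst (I := 𝓘(ℝ, GroupLieAlgebra I G))
        (I' := 𝓘(ℝ, LieDual I G).prod 𝓘(ℝ, LieDual I G)) (Y t, μ t, ξ t)) hr
    have hp := HasMFDerivAt.comp_hasMFDerivWithinAt t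
      (hasMFDerivAt_snd (I := 𝓘(ℝ, GroupLieAlgebra I G))
        (I' := 𝓘(ℝ, LieDual I G).prod 𝓘(ℝ, LieDual I G)) (Y t, μ t, ξ t)) hr
    have hμ := HasMFDerivAt.comp_hasMFDerivWithinAt t
      (hasMFDerivAt_fst (I := 𝓘(ℝ, LieDual I G)) (I' := 𝓘(ℝ, LieDual I G)) (μ t, ξ t)) hp
    have hξ := HasMFDerivAt.comp_hasMFDerivWithinAt t
      (hasMFDerivAt_snd (I := 𝓘(ℝ, LieDual I G)) (I' := 𝓘(ℝ, LieDual I G)) (μ t, ξ t)) hp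
    refine ⟨hx, ?_, ?_, ?_⟩
    · exact hasMFDerivWithinAt_iff_hasFDerivWithinAt.1 hY
    · exact hasMFDerivWithinAt_iff_hasFDerivWithinAt.1 hμ
    · exact hasMFDerivWithinAt_iff_hasFDerivWithinAt.1 hξ
  · have hY := h2.hasFDerivWithinAt.hasMFDerivWithinAt
    have hμ := h3.hasFDerivWithinAt.hasMFDerivWithinAt
    have hξ := h4.hasFDerivWithinAt.hasMFDerivWithinAt
    exact h1.prodMk (hY.prodMk (hμ.prodMk hξ))

end HamiltonianVectorField

end CubicHam

end

theorem mainTheorem7 {E : Type*} [NormedAddCommGroup E] [NormedSpace ℝ E] [FiniteDimensional ℝ E]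
    {H : Type*} [TopologicalSpace H] (I : ModelWithCorners ℝ E H) [I.Boundaryless]
    {G : Type*} [TopologicalSpace G] [ChartedSpace H G] [Group G] [LieGroup I ∞ G]
    [T2Space G] [CompactSpace G] [ConnectedSpace G]
    (m : CubicHam.Metric I G) (hm : CubicHam.IsBiInvariant I m) :
    (∃ Φ : Diffeomorph (CubicHam.cotangentModel (CubicHam.semiModel I G)) (CubicHam.phaseModel I G)
        (CubicHam.CotSemi I G) (CubicHam.Phase I G) ∞,
      ⇑Φ = CubicHam.leftTriv I ∧ ⇑Φ.symm = CubicHam.leftTrivInv I) ∧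
    (∀ z : CubicHam.Phase I G,
      CubicHam.hamCot I m (CubicHam.leftTrivInv I z) = CubicHam.ham I m z) ∧
    (∃! X : (z : CubicHam.Phase I G) → TangentSpace (CubicHam.phaseModel I G) z,
      CubicHam.IsHamiltonianVectorField (CubicHam.phaseModel I G) (CubicHam.phaseForm I)
        (CubicHam.ham I m) X) ∧
    (∀ X : (z : CubicHam.Phase I G) → TangentSpace (CubicHam.phaseModel I G) z,
      CubicHam.IsHamiltonianVectorField (CubicHam.phaseModel I G) (CubicHam.phaseForm I)
        (CubicHam.ham I m) X →
      (∀ (x : G) (Y : GroupLieAlgebra I G) (μ ξ : CubicHam.LieDual I G),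
        X (x, Y, μ, ξ) = CubicHam.phaseTangent I (x, Y, μ, ξ)
          (mulInvariantVectorField Y x, CubicHam.sharp I m ξ, 0, -μ + CubicHam.coad I Y ξ)) ∧
      (∀ (x : ℝ → G) (Y : ℝ → GroupLieAlgebra I G) (μ ξ : ℝ → CubicHam.LieDual I G) (s : Set ℝ),
        IsMIntegralCurveOn (fun t => ((x t, Y t, μ t, ξ t) : CubicHam.Phase I G)) X s ↔
        ∀ t ∈ s,
          HasMFDerivWithinAt 𝓘(ℝ, ℝ) I x s t
            ((1 : ℝ →L[ℝ] ℝ).smulRight (mulInvariantVectorField (Y t) (x t))) ∧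
          HasDerivWithinAt Y (CubicHam.sharp I m (ξ t)) s t ∧
          HasDerivWithinAt μ 0 s t ∧
          HasDerivWithinAt ξ (-μ t + CubicHam.coad I (Y t) (ξ t)) s t)) := by
  refine ⟨⟨CubicHam.leftTrivDiffeomorph I G, rfl, rfl⟩, CubicHam.hamCot_leftTrivInv I m,
    ⟨CubicHam.hamVectorField I m, CubicHam.isHamiltonianVectorField_hamVectorField I hm,
      fun X hX => hX.eq_hamVectorField I hm⟩, fun X hX => ?_⟩
  obtain rfl := hX.eq_hamVectorField I hm
  exact ⟨fun x Y μ ξ => rfl, CubicHam.isMIntegralCurveOn_hamVectorField_iff I m⟩
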